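/- **Theorem.** Let $S=k[x_1,\ldots,x_n]$ be the polynomial ring in $n\ge 1$ variables over a field $k$, and order the monomials of $S$ lexicographically with $x_1>x_2>\cdots>x_n$. For monomials $u\ge_{lex}v$ of degree $d$ let $\mathcal L(u,v)$ be the set of all monomials $w$ of degree $d$ with $u\ge_{lex}w\ge_{lex}v$; such a set is called a *lexsegment*. The *shadow* of a set $T$ of monomials is $\{wx_i : w\in T,\ 1\le i\le n\}$, and a lexsegment is *completely lexsegment* if all its iterated shadows are lexsegments. Let $u=x_1^{a_1}\cdots x_n^{a_n}$ with $a_1>0$ and $v$ be monomials of degree $d$ with $u\ge_{lex}v$ such that $\mathcal L(u,v)$ is completely lexsegment, and let $I=(\mathcal L(u,v))\subset S$. Then the following are equivalent: 1. $I$ has a linear resolution, i.e. for some $q$ there is a graded free resolution of the form $\cdots\to S(-q-2)^{\beta_2}\to S(-q-1)^{\beta_1}\to S(-q)^{\beta_0}\to I\to 0$ with finite ranks $\beta_i$; 2. $I$ has linear quotients, i.e. the minimal monomial generators of $I$ can be ordered as $u_1,\ldots,u_m$ in such a way that for each $2\le j\le m$ the colon ideal $(u_1,\ldots,u_{j-1}):u_j$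 is generated by a subset of $\{x_1,\ldots,x_n\}$; 3. $I$ has linear quotients with respect to the ordering $u_1\prec u_2\prec\cdots\prec u_m$ of its minimal monomial generators, where for $w=x_1^{\alpha_1}\cdots x_n^{\alpha_n}$ and $w'=x_1^{\beta_1}\cdots x_n^{\beta_n}$ of degree $d$ one sets $w\prec w'$ if $\alpha_1<\beta_1$, or $\alpha_1=\beta_1$ and $w>_{lex}w'$. -/

import Mathlib

namespace Lexsegment

open MvPolynomial

/-! The variables `x₁ > x₂ > … > xₙ` are `X 0, X 1, …, X (n - 1)`, and the monomial
`x₁ ^ α₁ ⋯ xₙ ^ αₙ` is represented by its exponent vector `α : Fin n →₀ ℕ`. Since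
`toLex α < toLex β` means that `α i < β i` at the first index `i` at which `α` and `β` differ,
`toLex` realizes the lexicographic order of monomials with `x₁ > x₂ > … > xₙ`. -/

/-- The lexsegment `L(u, v)`: the monomials `w` of degree `d` with `u ≥ w ≥ v` lexicographically. -/
def lexSegment {n : ℕ} (d : ℕ) (u v : Fin n →₀ ℕ) : Set (Fin n →₀ ℕ) :=
  {w | w.degree = d ∧ toLex w ≤ toLex u ∧ toLex v ≤ toLex w}

/-- A set `T` of monomials is a lexsegment in degree `d` if `T = L(u, v)` for some monomials
`u ≥ v` of degree `d`. -/
def IsLexSegment {n : ℕ} (d : ℕ) (T : Set (Fin n →₀ ℕ)) : Prop :=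
  ∃ u v : Fin n →₀ ℕ, u.degree = d ∧ v.degree = d ∧ toLex v ≤ toLex u ∧ T = lexSegment d u v

/-- The shadow of a set of monomials: all the products `w * xᵢ` with `w ∈ T`, `1 ≤ i ≤ n`. -/
def shadow {n : ℕ} (T : Set (Fin n →₀ ℕ)) : Set (Fin n →₀ ℕ) :=
  {m | ∃ w ∈ T, ∃ i : Fin n, m = w + Finsupp.single i 1}

/-- A lexsegment of degree `d` is completely lexsegment if all its iterated shadows are
lexsegments (of degree `d + i` for the `i`-th shadow). -/
def IsCompletelyLexSegment {n : ℕ} (d : ℕ) (T : Set (Fin n →₀ ℕ)) : Prop :=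
  ∀ i : ℕ, IsLexSegment (d + i) (shadow^[i] T)

/-- The ideal of `k[x₁, …, xₙ]` generated by a set of monomials. -/
noncomputable def monomialIdeal (k : Type*) [Field k] {n : ℕ} (T : Set (Fin n →₀ ℕ)) :
    Ideal (MvPolynomial (Fin n) k) :=
  Ideal.span ((fun m : Fin n →₀ ℕ => monomial m (1 : k)) '' T)

/-- `G(I)`: the monomials in `I` that are minimal with respect to divisibility. When `I` is a
monomial ideal, this is its minimal monomial set of generators. -/
def minGens {k : Type*} [Field k] {n : ℕ} (I : Ideal (MvPolynomial (Fin n) k)) :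
    Set (Fin n →₀ ℕ) :=
  {m | Minimal (fun m' : Fin n →₀ ℕ => monomial m' (1 : k) ∈ I) m}

/-- The list `l = [u₁, …, uₘ]` is an ordering of the elements of `G(I)` for which each colon ideal
`(u₁, …, u_{j-1}) : u_j`, `2 ≤ j ≤ m`, is generated by a subset of the set of variables. -/
def IsLinearQuotientsOrdering {k : Type*} [Field k] {n : ℕ}
    (I : Ideal (MvPolynomial (Fin n) k)) (l : List (Fin n →₀ ℕ)) : Prop :=
  l.Nodup ∧ (∀ m, m ∈ l ↔ m ∈ minGens I) ∧
    ∀ (j : ℕ) (hj : j < l.length), 0 < j →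
      ∃ A : Set (Fin n),
        (monomialIdeal k {m | m ∈ l.take j}).colon {monomial (l[j]'hj) (1 : k)} =
          Ideal.span ((X : Fin n → MvPolynomial (Fin n) k) '' A)

/-- `I` has linear quotients: some ordering of `G(I)` has all its colon ideals generated by
variables. -/
def HasLinearQuotients {k : Type*} [Field k] {n : ℕ}
    (I : Ideal (MvPolynomial (Fin n) k)) : Prop :=
  ∃ l : List (Fin n →₀ ℕ), IsLinearQuotientsOrdering I l

/-- `I` has linear quotients with respect to `r`: this holds for the ordering of `G(I)` in which
the generators increase along `r`. -/
def HasLinearQuotientsWrt {k : Type*} [Field k] {n : ℕ}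
    (r : (Fin n →₀ ℕ) → (Fin n →₀ ℕ) → Prop) (I : Ideal (MvPolynomial (Fin n) k)) : Prop :=
  ∃ l : List (Fin n →₀ ℕ), l.Pairwise r ∧ IsLinearQuotientsOrdering I l

/-- The order `≺`: `w ≺ w'` if `ν₁(w) < ν₁(w')`, or `ν₁(w) = ν₁(w')` and `w > w'`
lexicographically. -/
def prec {n : ℕ} [NeZero n] (w w' : Fin n →₀ ℕ) : Prop :=
  w 0 < w' 0 ∨ w 0 = w' 0 ∧ toLex w' < toLex w

/-- `I` has a `q`-linear resolution, that is, a graded free resolution of the form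
`⋯ → S(-q-2)^{β₂} → S(-q-1)^{β₁} → S(-q)^{β₀} → I → 0`, where `S = k[x₁, …, xₙ]`.
A graded homomorphism `S(-q)^{β₀} → I` is a row `f` of forms of degree `q`, and a graded
homomorphism `S(-q-i-1)^{β_{i+1}} → S(-q-i)^{β_i}` is a `β_i × β_{i+1}` matrix `A i` of linear
forms. As all the entries lie in the ideal `(x₁, …, xₙ)`, such a resolution is automatically
minimal. -/
def HasLinearResolutionOfDegree {k : Type*} [Field k] {n : ℕ} (q : ℕ)
    (I : Ideal (MvPolynomial (Fin n) k)) : Prop :=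
  ∃ (β : ℕ → ℕ) (f : Fin (β 0) → MvPolynomial (Fin n) k)
    (A : (i : ℕ) → Matrix (Fin (β i)) (Fin (β (i + 1))) (MvPolynomial (Fin n) k)),
    (∀ b, (f b).IsHomogeneous q) ∧
    (∀ i a b, (A i a b).IsHomogeneous 1) ∧
    LinearMap.range (Fintype.linearCombination (MvPolynomial (Fin n) k) f) = I ∧
    LinearMap.ker (Fintype.linearCombination (MvPolynomial (Fin n) k) f) =
      LinearMap.range (A 0).mulVecLin ∧
    ∀ i, LinearMap.ker (A i).mulVecLin = LinearMap.range (A (i + 1)).mulVecLin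

/-- `I` has a linear resolution: a `q`-linear one for some `q`. -/
def HasLinearResolution {k : Type*} [Field k] {n : ℕ}
    (I : Ideal (MvPolynomial (Fin n) k)) : Prop :=
  ∃ q : ℕ, HasLinearResolutionOfDegree q I

end Lexsegment

/-! The bridge between resolutions and monomials is Koszul homology. For a graded submodule M of a
free module, write an element of its Koszul complex as a family of coefficients in M. Then M,
generated in degree e, has a linear resolution exactly when this homology lives only in coefficient
degree e (`KoszulLinear`). Both directions are obtained by chasing cycles through 0 → K → F → M → 0
with F free, whose own Koszul complex is exact in positive coefficient degree.

Linear quotients imply linearity: if (T) : u is generated by variables, the quotient of (T, u) by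
(T) is a shift of S modulo variables, whose Koszul homology has coefficient degree 0, so linearity
passes from (T) to (T, u) (`koszulLinear_insert`).

Conversely, suppose I is linear. If u and v have the same exponent of x₁, complete lexness alone
makes u the largest monomial with that exponent. Otherwise let w be the largest monomial below v
with the same x₁-exponent as v, and x_r its last variable. All xᵢw with i < r lie in I, so the
boundary of w·e₁∧⋯∧e_{r-1} is a cycle of I. It must bound inside I, and this forces x₁w/x_r ∈ I
(`KoszulLinear.exchange_mem`). By monotonicity x₁z/x_q ≤ u for every such z below v with last
variable x_q (`LastExchangeLe`). In either case, any w' ≺ w in L(u, v) admits an exchange in a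
variable occurring more often in w' than in w (`exists_exchange`), which is linear quotients for ≺.
-/

namespace Lexsegment

open MvPolynomial

/-! ### The Koszul complex of the variables and its contracting homotopies -/

section Koszul

variable {k : Type*} [Field k] {n : ℕ}

/-- The sign of the basis vector `eᵢ ∧ e_τ`, and `0` if `i ∈ τ`. -/
def koszulSign (i : Fin n) (τ : Finset (Fin n)) : ℤ :=
  if i ∈ τ then 0 else (-1) ^ (τ.filter (· < i)).card

theorem koszulSign_of_mem {i : Fin n} {τ : Finset (Fin n)} (h : i ∈ τ) : koszulSign i τ = 0 :=
  if_pos h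

theorem koszulSign_mul_self {i : Fin n} {τ : Finset (Fin n)} (h : i ∉ τ) :
    koszulSign i τ * koszulSign i τ = 1 := by
  rw [koszulSign, if_neg h, ← mul_pow]
  norm_num

/-- Anticommutativity of the exterior product, behind the vanishing of the squared differential. -/
theorem koszulSign_swap {i j : Fin n} (hij : i ≠ j) (τ : Finset (Fin n)) :
    koszulSign i τ * koszulSign j (insert i τ) = -(koszulSign j τ * koszulSign i (insert j τ)) := by
  wlog h : i < j generalizing i j
  · rw [this hij.symm (lt_of_le_of_ne (not_lt.1 h) hij.symm), neg_neg]
  by_cases hi : i ∈ τ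
  · simp [koszulSign, hi]
  by_cases hj : j ∈ τ
  · simp [koszulSign, hj]
  have h1 : (insert i τ).filter (· < j) = insert i (τ.filter (· < j)) := by
    rw [Finset.filter_insert, if_pos h]
  have h2 : (insert j τ).filter (· < i) = τ.filter (· < i) := by
    rw [Finset.filter_insert, if_neg h.asymm]
  have h3 : i ∉ τ.filter (· < j) := by simp [hi]
  simp only [koszulSign, hi, hj, if_false, Finset.mem_insert, hij, hij.symm, or_self, h1, h2,
    Finset.card_insert_of_notMem h3, pow_succ]
  ring

/-- This cancels the cross terms in `koszul_homotopy`. -/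
theorem koszulSign_insert_mul {i j : Fin n} (hij : i ≠ j) (σ : Finset (Fin n)) :
    koszulSign i (insert j σ) * koszulSign j (insert i σ) + koszulSign j σ * koszulSign i σ = 0 := by
  by_cases hi : i ∈ σ
  · simp [koszulSign, hi]
  have h1 := koszulSign_swap hij σ
  have h2 := koszulSign_mul_self hi
  have h3 : koszulSign i (insert j σ) * koszulSign i (insert j σ) = 1 :=
    koszulSign_mul_self (by simp [hij, hi])
  linear_combination (koszulSign i (insert j σ) * koszulSign i σ) * h1 -
    koszulSign i (insert j σ) * koszulSign j (insert i σ) * h2 -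
    koszulSign i σ * koszulSign j σ * h3

variable {N N' : Type*} [AddCommGroup N] [Module (MvPolynomial (Fin n) k) N]
  [AddCommGroup N'] [Module (MvPolynomial (Fin n) k) N']

/-- The differential of the Koszul complex of `x₁, …, xₙ` with coefficients in `N`. An element
`z` of the complex is given by its coefficients `z τ` with respect to the `e_τ`. -/
noncomputable def koszulD (k : Type*) [Field k] {n : ℕ} {N : Type*} [AddCommGroup N]
    [Module (MvPolynomial (Fin n) k) N] (z : Finset (Fin n) → N) (τ : Finset (Fin n)) : N :=
  ∑ i, koszulSign i τ • (X i : MvPolynomial (Fin n) k) • z (insert i τ)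

theorem koszulD_add (y z : Finset (Fin n) → N) :
    koszulD k (y + z) = koszulD k y + koszulD k z := by
  ext τ; simp [koszulD, Finset.sum_add_distrib]

theorem koszulD_sub (y z : Finset (Fin n) → N) :
    koszulD k (y - z) = koszulD k y - koszulD k z := by
  ext τ; simp [koszulD, smul_sub]

theorem koszulD_zero : koszulD k (0 : Finset (Fin n) → N) = 0 := by
  ext τ; simp [koszulD]

theorem koszulD_map (φ : N →ₗ[MvPolynomial (Fin n) k] N') (z : Finset (Fin n) → N) :
    koszulD k (fun τ => φ (z τ)) = fun τ => φ (koszulD k z τ) := by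
  ext τ; simp [koszulD]

theorem koszulD_mem (M : Submodule (MvPolynomial (Fin n) k) N) {z : Finset (Fin n) → N}
    (hz : ∀ τ, z τ ∈ M) (τ : Finset (Fin n)) : koszulD k z τ ∈ M :=
  M.sum_mem fun _ _ => zsmul_mem (M.smul_mem _ (hz _)) _

theorem koszulD_koszulD (z : Finset (Fin n) → N) : koszulD k (koszulD k z) = 0 := by
  ext τ
  simp only [koszulD, Finset.smul_sum, Pi.zero_apply]
  rw [← Finset.sum_product']
  refine Finset.sum_involution (fun p _ => (p.2, p.1)) ?_ ?_ (by simp) (by simp)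
  · rintro ⟨i, j⟩ -
    rcases eq_or_ne i j with rfl | hij
    · simp [koszulSign_of_mem (Finset.mem_insert_self i τ)]
    · simp only [smul_comm (X _ : MvPolynomial (Fin n) k) (_ : ℤ)]
      rw [smul_smul (koszulSign i τ), smul_smul (koszulSign j τ), koszulSign_swap hij, neg_smul,
        Finset.insert_comm, smul_comm (X i : MvPolynomial (Fin n) k), neg_add_cancel]
  · rintro ⟨i, j⟩ - h h'
    obtain rfl : j = i := congrArg Prod.fst h'
    exact h (by simp [koszulSign_of_mem (Finset.mem_insert_self j τ)])

theorem koszulD_eq_zero_of_card {z : Finset (Fin n) → N} {m : ℕ}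
    (hz : ∀ τ : Finset (Fin n), m + 1 ≤ τ.card → z τ = 0) (τ : Finset (Fin n))
    (hτ : m ≤ τ.card) : koszulD k z τ = 0 := by
  refine Finset.sum_eq_zero fun i _ => ?_
  by_cases hi : i ∈ τ
  · simp [koszulSign_of_mem hi]
  · rw [hz _ (by rw [Finset.card_insert_of_notMem hi]; omega), smul_zero, smul_zero]

theorem koszulD_isHomogeneous {z : Finset (Fin n) → MvPolynomial (Fin n) k} {c : ℕ}
    (hz : ∀ τ, (z τ).IsHomogeneous c) (τ : Finset (Fin n)) :
    (koszulD k z τ).IsHomogeneous (c + 1) := by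
  refine IsHomogeneous.sum _ _ _ fun i _ => ?_
  refine zsmul_mem (K := homogeneousSubmodule (Fin n) k (c + 1)) ?_ _
  rw [add_comm]
  exact (isHomogeneous_X k i).mul (hz _)

/-! ### Contracting homotopies -/

theorem isHomogeneous_divMonomial {p : MvPolynomial (Fin n) k} {c e : ℕ} {m : Fin n →₀ ℕ}
    (hm : m.degree = e) (hp : p.IsHomogeneous (c + e)) : (p.divMonomial m).IsHomogeneous c := by
  intro t ht
  rw [coeff_divMonomial] at ht
  have h2 := hp ht
  rw [map_add, show Finsupp.weight 1 m = m.degree by rw [Finsupp.degree_eq_weight_one]; rfl] at h2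
  omega

theorem isHomogeneous_modMonomial {p : MvPolynomial (Fin n) k} {c : ℕ} {m : Fin n →₀ ℕ}
    (hp : p.IsHomogeneous c) : (p.modMonomial m).IsHomogeneous c := by
  intro t ht
  by_cases h : m ≤ t
  · exact absurd (coeff_modMonomial_of_le p h) ht
  · rw [coeff_modMonomial_of_not_le p h] at ht
    exact hp ht

theorem X_mul_divMonomial_of_ne {i j : Fin n} (hij : i ≠ j) (p : MvPolynomial (Fin n) k) :
    (X i * p).divMonomial (Finsupp.single j 1) = X i * p.divMonomial (Finsupp.single j 1) := by
  ext m
  rw [coeff_divMonomial, coeff_X_mul', coeff_X_mul', coeff_divMonomial]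
  have : i ∈ (Finsupp.single j 1 + m).support ↔ i ∈ m.support := by
    simp [Finsupp.single_eq_of_ne hij]
  by_cases h : i ∈ m.support
  · rw [if_pos h, if_pos (this.2 h)]
    congr 1
    ext l
    simp only [Finsupp.coe_tsub, Pi.sub_apply, Finsupp.add_apply, Finsupp.single_apply]
    rcases eq_or_ne j l with rfl | hl
    · simp [hij]
    · simp [hl]
  · rw [if_neg h, if_neg (mt this.1 h)]

/-- Division by `xⱼ` as an additive map. -/
noncomputable def divX (j : Fin n) : MvPolynomial (Fin n) k →+ MvPolynomial (Fin n) k where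
  toFun p := p.divMonomial (Finsupp.single j 1)
  map_zero' := zero_divMonomial _
  map_add' p q := add_divMonomial p q _

/-- The homotopy `eⱼ ∧ -` combined with division by `xⱼ`. -/
noncomputable def koszulH (j : Fin n) (z : Finset (Fin n) → MvPolynomial (Fin n) k)
    (τ : Finset (Fin n)) : MvPolynomial (Fin n) k :=
  if j ∈ τ then koszulSign j (τ.erase j) • divX j (z (τ.erase j)) else 0

/-- The terms of `z` that involve neither `xⱼ` nor `eⱼ`. -/
noncomputable def koszulProj (j : Fin n) (z : Finset (Fin n) → MvPolynomial (Fin n) k)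
    (τ : Finset (Fin n)) : MvPolynomial (Fin n) k :=
  if j ∈ τ then 0 else (z τ).modMonomial (Finsupp.single j 1)

/-- Division by xⱼ commutes with multiplication by the other variables, so the terms with i ≠ j
cancel by signs. The term i = j returns `z τ` when j ∈ τ, and `z τ` minus its xⱼ-free part when j ∉
τ. -/
theorem koszul_homotopy (j : Fin n) (z : Finset (Fin n) → MvPolynomial (Fin n) k) :
    z = koszulD k (koszulH j z) + koszulH j (koszulD k z) + koszulProj j z := by
  ext1 τ
  by_cases hj : j ∈ τ
  · obtain ⟨σ, hσ, rfl⟩ : ∃ σ, j ∉ σ ∧ τ = insert j σ :=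
      ⟨τ.erase j, Finset.notMem_erase j τ, (Finset.insert_erase hj).symm⟩
    have h1 : koszulD k (koszulH j z) (insert j σ) =
        ∑ i ∈ Finset.univ.erase j, koszulSign i (insert j σ) • (X i : MvPolynomial (Fin n) k) •
          koszulSign j (insert i σ) • divX j (z (insert i σ)) := by
      rw [koszulD, ← Finset.sum_erase_add _ _ (Finset.mem_univ j),
        koszulSign_of_mem (Finset.mem_insert_self j σ), zero_smul, add_zero]
      refine Finset.sum_congr rfl fun i hi => ?_
      have hij : i ≠ j := Finset.ne_of_mem_erase hi
      have : (insert i (insert j σ)).erase j = insert i σ := by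
        rw [Finset.insert_comm, Finset.erase_insert]
        simp [hij.symm, hσ]
      rw [koszulH, if_pos (by simp), this]
    have h2 : koszulH j (koszulD k z) (insert j σ) =
        koszulSign j σ • (∑ i ∈ Finset.univ.erase j, koszulSign i σ •
          (X i : MvPolynomial (Fin n) k) • divX j (z (insert i σ))) + z (insert j σ) := by
      rw [koszulH, if_pos (Finset.mem_insert_self j σ), Finset.erase_insert hσ, koszulD, map_sum,
        ← Finset.sum_erase_add _ _ (Finset.mem_univ j), smul_add]
      congr 1
      · refine congrArg _ (Finset.sum_congr rfl fun i hi => ?_)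
        rw [map_zsmul]
        exact congrArg _ (X_mul_divMonomial_of_ne (Finset.ne_of_mem_erase hi) _)
      · rw [map_zsmul, smul_smul, koszulSign_mul_self hσ, one_smul]
        exact X_mul_divMonomial j _
    have h3 : koszulD k (koszulH j z) (insert j σ) + koszulH j (koszulD k z) (insert j σ) =
        z (insert j σ) := by
      rw [h1, h2, ← add_assoc, Finset.smul_sum, ← Finset.sum_add_distrib, Finset.sum_eq_zero,
        zero_add]
      intro i hi
      rw [smul_comm (X i : MvPolynomial (Fin n) k), smul_smul, smul_smul, ← add_smul,
        koszulSign_insert_mul (Finset.ne_of_mem_erase hi), zero_smul]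
    simp [koszulProj, h3]
  · have h1 : koszulD k (koszulH j z) τ = X j * divX j (z τ) := by
      rw [koszulD, Finset.sum_eq_single j]
      · rw [koszulH, if_pos (Finset.mem_insert_self j τ), Finset.erase_insert hj,
          smul_comm (X j : MvPolynomial (Fin n) k), smul_smul, koszulSign_mul_self hj, one_smul,
          smul_eq_mul]
      · intro i _ hij
        rw [koszulH, if_neg (by simp [hj, hij.symm]), smul_zero, smul_zero]
      · simp
    have h2 : koszulH j (koszulD k z) τ = 0 := if_neg hj
    rw [Pi.add_apply, Pi.add_apply, h1, h2, add_zero, koszulProj, if_neg hj]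
    exact (divMonomial_add_modMonomial_single (z τ) j).symm

theorem koszulH_isHomogeneous (j : Fin n) {z : Finset (Fin n) → MvPolynomial (Fin n) k} {c : ℕ}
    (hz : ∀ τ, (z τ).IsHomogeneous (c + 1)) (τ : Finset (Fin n)) :
    (koszulH j z τ).IsHomogeneous c := by
  rw [koszulH]
  split_ifs
  · exact zsmul_mem (K := homogeneousSubmodule (Fin n) k c)
      (isHomogeneous_divMonomial (Finsupp.degree_single j 1) (hz _)) _
  · exact isHomogeneous_zero _ _ _

theorem koszulProj_isHomogeneous (j : Fin n) {z : Finset (Fin n) → MvPolynomial (Fin n) k} {c : ℕ}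
    (hz : ∀ τ, (z τ).IsHomogeneous c) (τ : Finset (Fin n)) :
    (koszulProj j z τ).IsHomogeneous c := by
  rw [koszulProj]
  split_ifs
  · exact isHomogeneous_zero _ _ _
  · exact isHomogeneous_modMonomial (hz _)

theorem divX_mem_span_X {A : Set (Fin n)} {j : Fin n} (hj : j ∉ A) {p : MvPolynomial (Fin n) k}
    (hp : p ∈ Ideal.span ((X : Fin n → MvPolynomial (Fin n) k) '' A)) :
    divX j p ∈ Ideal.span ((X : Fin n → MvPolynomial (Fin n) k) '' A) := by
  rw [mem_ideal_span_X_image] at hp ⊢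
  intro m hm
  have : (divX j p).coeff m = p.coeff (Finsupp.single j 1 + m) := coeff_divMonomial _ _ _
  rw [mem_support_iff, this, ← mem_support_iff] at hm
  obtain ⟨i, hi, h⟩ := hp _ hm
  refine ⟨i, hi, ?_⟩
  rwa [Finsupp.add_apply, Finsupp.single_eq_of_ne (by rintro rfl; exact hj hi), zero_add] at h

/-- In positive coefficient degree, a Koszul cycle of `S / (xₐ : a ∈ A)` is a boundary. -/
theorem exists_koszulD_of_mem_span_X (A : Set (Fin n))
    {z : Finset (Fin n) → MvPolynomial (Fin n) k} {c : ℕ}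
    (hz : ∀ τ, (z τ).IsHomogeneous (c + 1))
    (hd : ∀ τ, koszulD k z τ ∈ Ideal.span ((X : Fin n → MvPolynomial (Fin n) k) '' A)) :
    ∃ y : Finset (Fin n) → MvPolynomial (Fin n) k, (∀ τ, (y τ).IsHomogeneous c) ∧
      ∀ τ, z τ - koszulD k y τ ∈ Ideal.span ((X : Fin n → MvPolynomial (Fin n) k) '' A) := by
  classical
  -- The homotopies for j ∉ A are applied one at a time; each preserves the ideal and removes xⱼ
  -- from the remaining representative `z'`.
  have key : ∀ B : Finset (Fin n), (∀ j ∈ B, j ∉ A) →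
      ∃ y z' : Finset (Fin n) → MvPolynomial (Fin n) k, (∀ τ, (y τ).IsHomogeneous c) ∧
        (∀ τ, (z' τ).IsHomogeneous (c + 1)) ∧
        (∀ τ, z τ - koszulD k y τ - z' τ ∈
          Ideal.span ((X : Fin n → MvPolynomial (Fin n) k) '' A)) ∧
        ∀ τ, ∀ m ∈ (z' τ).support, ∀ j ∈ B, m j = 0 := by
    intro B
    induction B using Finset.induction_on with
    | empty =>
      intro _
      exact ⟨0, z, fun _ => isHomogeneous_zero _ _ _, hz, by simp [koszulD_zero], by simp⟩
    | insert j B hj ih =>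
      intro hA
      obtain ⟨y, z', hy, hz', hyz, hm⟩ := ih fun i hi => hA i (Finset.mem_insert_of_mem hi)
      have hjA := hA j (Finset.mem_insert_self j B)
      refine ⟨y + koszulH j z', koszulProj j z',
        fun τ => (hy τ).add (koszulH_isHomogeneous j hz' τ), koszulProj_isHomogeneous j hz', ?_, ?_⟩
      · have hdz' : ∀ τ, koszulD k z' τ ∈
            Ideal.span ((X : Fin n → MvPolynomial (Fin n) k) '' A) := by
          have h1 := koszulD_mem (k := k) _ hyz
          have h2 : koszulD k (fun τ => z τ - koszulD k y τ - z' τ) =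
              koszulD k z - koszulD k z' := by
            have : (fun τ => z τ - koszulD k y τ - z' τ) = z - koszulD k y - z' := rfl
            rw [this, koszulD_sub, koszulD_sub, koszulD_koszulD, sub_zero]
          intro τ
          have h3 := h1 τ
          rw [h2, Pi.sub_apply] at h3
          exact (Submodule.sub_mem_iff_right _ (hd τ)).1 h3
        intro τ
        have h1 := congrFun (koszul_homotopy j z') τ
        have h2 : koszulH j (koszulD k z') τ ∈
            Ideal.span ((X : Fin n → MvPolynomial (Fin n) k) '' A) := by
          rw [koszulH]
          split_ifs
          · exact zsmul_mem (divX_mem_span_X hjA (hdz' _)) _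
          · exact zero_mem _
        have h3 := add_mem (hyz τ) h2
        simp only [Pi.add_apply] at h1
        rw [koszulD_add]
        convert h3 using 1
        rw [Pi.add_apply]
        linear_combination h1
      · intro τ m hmem i hi
        rw [koszulProj] at hmem
        split_ifs at hmem with h
        · simp at hmem
        · rw [mem_support_iff] at hmem
          by_cases hle : Finsupp.single j 1 ≤ m
          · exact absurd (coeff_modMonomial_of_le _ hle) hmem
          · rw [coeff_modMonomial_of_not_le _ hle, ← mem_support_iff] at hmem
            rcases Finset.mem_insert.1 hi with rfl | hi
            · rw [Finsupp.single_le_iff] at hle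
              omega
            · exact hm τ m hmem i hi
  obtain ⟨y, z', hy, hz', hyz, hm⟩ := key {j | j ∉ A} (by simp)
  refine ⟨y, hy, fun τ => ?_⟩
  -- Only variables from A are left in `z'`, and its degree c + 1 is positive, so each of its
  -- monomials involves one of them.
  have h : z' τ ∈ Ideal.span ((X : Fin n → MvPolynomial (Fin n) k) '' A) := by
    rw [mem_ideal_span_X_image]
    intro m hmem
    have hdeg : m.degree = c + 1 :=
      by_contra fun h => mem_support_iff.1 hmem ((hz' τ).coeff_eq_zero h)
    by_contra! hcon
    have : m = 0 := by
      ext i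
      by_cases hi : i ∈ A
      · exact hcon i hi
      · exact hm τ m hmem i (by simpa using hi)
    rw [this, map_zero] at hdeg
    omega
  simpa using add_mem (hyz τ) h

/-- The Koszul complex of a free module is exact in positive coefficient degree. -/
theorem exists_koszulD_eq {ι : Type*} {z : Finset (Fin n) → ι → MvPolynomial (Fin n) k} {c : ℕ}
    (hz : ∀ τ i, (z τ i).IsHomogeneous (c + 1)) (hd : koszulD k z = 0) :
    ∃ y : Finset (Fin n) → ι → MvPolynomial (Fin n) k, (∀ τ i, (y τ i).IsHomogeneous c) ∧
      koszulD k y = z := by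
  have h : ∀ i, ∃ y : Finset (Fin n) → MvPolynomial (Fin n) k, (∀ τ, (y τ).IsHomogeneous c) ∧
      koszulD k y = fun τ => z τ i := by
    intro i
    have hdi : koszulD k (fun τ => z τ i) = 0 := by
      refine (koszulD_map (k := k) (LinearMap.proj (R := MvPolynomial (Fin n) k)
        (φ := fun _ : ι => MvPolynomial (Fin n) k) i) z).trans ?_
      rw [hd]
      rfl
    obtain ⟨y, hy, hyz⟩ := exists_koszulD_of_mem_span_X (A := ∅) (fun τ => hz τ i)
      (by simp [hdi])
    refine ⟨y, hy, funext fun τ => ?_⟩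
    have := hyz τ
    rw [Set.image_empty, Ideal.span_empty, Ideal.mem_bot] at this
    exact (sub_eq_zero.1 this).symm
  choose y hy hyz using h
  refine ⟨fun τ i => y i τ, fun τ i => hy i τ, ?_⟩
  ext1 τ
  ext1 i
  have := koszulD_map (k := k) (LinearMap.proj (R := MvPolynomial (Fin n) k)
    (φ := fun _ : ι => MvPolynomial (Fin n) k) i) (fun τ i => y i τ)
  exact (congrFun this τ).symm.trans (congrFun (hyz i) τ)

end Koszul

/-! ### Linear resolutions and Koszul homology -/

section LinearResolution

variable {k : Type*} [Field k] {n : ℕ} {ι : Type*}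

theorem koszulD_apply (z : Finset (Fin n) → ι → MvPolynomial (Fin n) k) (τ : Finset (Fin n))
    (i : ι) : koszulD k z τ i = koszulD k (fun σ => z σ i) τ := by
  simp [koszulD, mul_left_comm]

/-- A submodule of a free module is graded if it contains the homogeneous components of each of
its elements. -/
def IsGraded (M : Submodule (MvPolynomial (Fin n) k) (ι → MvPolynomial (Fin n) k)) : Prop :=
  ∀ x ∈ M, ∀ c, (fun i => homogeneousComponent c (x i)) ∈ M

/-- The Koszul homology of `M` is concentrated in coefficient degree `e`. -/
def KoszulLinear (e : ℕ) (M : Submodule (MvPolynomial (Fin n) k) (ι → MvPolynomial (Fin n) k)) :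
    Prop :=
  (∀ c < e, ∀ x ∈ M, (∀ i, (x i).IsHomogeneous c) → x = 0) ∧
    ∀ c, e ≤ c → ∀ z : Finset (Fin n) → ι → MvPolynomial (Fin n) k, (∀ τ, z τ ∈ M) →
      (∀ τ i, (z τ i).IsHomogeneous (c + 1)) → koszulD k z = 0 →
      ∃ y : Finset (Fin n) → ι → MvPolynomial (Fin n) k, (∀ τ, y τ ∈ M) ∧
        (∀ τ i, (y τ i).IsHomogeneous c) ∧ koszulD k y = z

/-- The Koszul homology of `M` in homological degrees less than `m` vanishes in coefficient
degrees greater than `e`. -/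
def KoszulLinearBelow (m e : ℕ)
    (M : Submodule (MvPolynomial (Fin n) k) (ι → MvPolynomial (Fin n) k)) : Prop :=
  ∀ c, e ≤ c → ∀ z : Finset (Fin n) → ι → MvPolynomial (Fin n) k, (∀ τ, z τ ∈ M) →
    (∀ τ i, (z τ i).IsHomogeneous (c + 1)) → (∀ τ, m ≤ τ.card → z τ = 0) → koszulD k z = 0 →
    ∃ y : Finset (Fin n) → ι → MvPolynomial (Fin n) k, (∀ τ, y τ ∈ M) ∧
      (∀ τ i, (y τ i).IsHomogeneous c) ∧ koszulD k y = z

theorem homogeneousComponent_mul_of_left {p : MvPolynomial (Fin n) k} {e : ℕ}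
    (hp : p.IsHomogeneous e) (q : MvPolynomial (Fin n) k) (c : ℕ) :
    homogeneousComponent c (p * q) = if e ≤ c then p * homogeneousComponent (c - e) q else 0 := by
  induction q using MvPolynomial.induction_on' with
  | monomial m a =>
    rw [homogeneousComponent_of_mem (hp.mul (isHomogeneous_monomial a rfl)),
      homogeneousComponent_of_mem (isHomogeneous_monomial a rfl)]
    split_ifs <;> first | rfl | (exfalso; omega) | simp
  | add q r hq hr =>
    rw [mul_add, map_add, hq, hr, map_add]
    split_ifs
    · rw [mul_add]
    · rw [add_zero]

variable {b : ℕ} {B : Matrix ι (Fin b) (MvPolynomial (Fin n) k)} {e : ℕ}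

theorem homogeneousComponent_mulVec (hB : ∀ i j, (B i j).IsHomogeneous e)
    (y : Fin b → MvPolynomial (Fin n) k) (c : ℕ) (i : ι) :
    homogeneousComponent c (B.mulVec y i) =
      if e ≤ c then B.mulVec (fun j => homogeneousComponent (c - e) (y j)) i else 0 := by
  simp only [Matrix.mulVec, dotProduct, map_sum, homogeneousComponent_mul_of_left (hB _ _)]
  split_ifs
  · rfl
  · simp

theorem mulVec_isHomogeneous (hB : ∀ i j, (B i j).IsHomogeneous e)
    {y : Fin b → MvPolynomial (Fin n) k} {c : ℕ} (hy : ∀ j, (y j).IsHomogeneous c) (i : ι) :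
    (B.mulVec y i).IsHomogeneous (e + c) :=
  IsHomogeneous.sum _ _ _ fun j _ => (hB i j).mul (hy j)

theorem exists_homogeneous_mulVec_eq (hB : ∀ i j, (B i j).IsHomogeneous e)
    {x : ι → MvPolynomial (Fin n) k} (hx : x ∈ LinearMap.range B.mulVecLin) {c : ℕ}
    (hc : ∀ i, (x i).IsHomogeneous (e + c)) :
    ∃ y : Fin b → MvPolynomial (Fin n) k, (∀ j, (y j).IsHomogeneous c) ∧ B.mulVecLin y = x := by
  obtain ⟨y, rfl⟩ := hx
  refine ⟨fun j => homogeneousComponent c (y j),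
    fun j => homogeneousComponent_isHomogeneous c (y j), funext fun i => ?_⟩
  have h := homogeneousComponent_mulVec hB y (e + c) i
  rw [if_pos (Nat.le_add_right e c), Nat.add_sub_cancel_left] at h
  exact h.symm.trans (homogeneousComponent_eq_self (hc i))

theorem eq_zero_of_mem_range_of_lt (hB : ∀ i j, (B i j).IsHomogeneous e)
    {x : ι → MvPolynomial (Fin n) k} (hx : x ∈ LinearMap.range B.mulVecLin) {c : ℕ} (hce : c < e)
    (hc : ∀ i, (x i).IsHomogeneous c) : x = 0 := by
  obtain ⟨y, rfl⟩ := hx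
  funext i
  have h := homogeneousComponent_mulVec hB y c i
  rw [if_neg (not_le.2 hce)] at h
  exact (homogeneousComponent_eq_self (hc i)).symm.trans h

theorem isGraded_ker (hB : ∀ i j, (B i j).IsHomogeneous e) :
    IsGraded (LinearMap.ker B.mulVecLin) := by
  intro y hy c
  rw [LinearMap.mem_ker] at hy ⊢
  funext i
  have h := homogeneousComponent_mulVec hB y (e + c) i
  rw [if_pos (Nat.le_add_right e c), Nat.add_sub_cancel_left] at h
  have hy' : B.mulVec y i = 0 := congrFun hy i
  rw [hy', map_zero] at h
  exact h.symm

/-- A cycle z of the kernel bounds some y in the free module. Then B y is a cycle of the image,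
bounded by some B s, and y corrected by the boundary of s lies in the kernel and still bounds z. The
hypothesis `h0` excludes constant syzygies. -/
theorem KoszulLinear.ker (hB : ∀ i j, (B i j).IsHomogeneous e)
    (h : KoszulLinear e (LinearMap.range B.mulVecLin))
    (h0 : ∀ a : Fin b → k, B.mulVec (fun j => C (a j)) = 0 → a = 0) :
    KoszulLinear 1 (LinearMap.ker B.mulVecLin) := by
  refine ⟨fun c hc x hx hhom => ?_, fun c hc z hz hhom hd => ?_⟩
  · obtain rfl : c = 0 := by omega
    have hx' : x = fun j => C (coeff 0 (x j)) := funext fun j => by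
      rw [← homogeneousComponent_zero, homogeneousComponent_eq_self (hhom j)]
    have := h0 (fun j => coeff 0 (x j)) (hx' ▸ hx)
    rw [hx']
    funext j
    rw [congrFun this j, Pi.zero_apply, map_zero, Pi.zero_apply]
  · obtain ⟨c, rfl⟩ : ∃ c', c = c' + 1 := ⟨c - 1, by omega⟩
    obtain ⟨y, hy, rfl⟩ := exists_koszulD_eq hhom hd
    obtain ⟨t, ht, htc, htd⟩ := h.2 (e + c) (by omega) (fun τ => B.mulVecLin (y τ))
      (fun τ => ⟨_, rfl⟩) (fun τ => mulVec_isHomogeneous hB (hy τ)) (by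
        rw [koszulD_map]
        funext τ
        exact hz τ)
    choose s hs hst using fun τ => exists_homogeneous_mulVec_eq hB (ht τ) (htc τ)
    refine ⟨y - koszulD k s, fun τ => ?_, fun τ i => ?_, ?_⟩
    · have := congrFun (koszulD_map B.mulVecLin s) τ
      rw [LinearMap.mem_ker, Pi.sub_apply, map_sub, ← this, funext hst, htd, sub_self]
    · rw [Pi.sub_apply, Pi.sub_apply, koszulD_apply]
      exact (hy τ i).sub (koszulD_isHomogeneous (fun σ => hs σ i) τ)
    · rw [koszulD_sub, koszulD_koszulD, sub_zero]

/-- The connecting map sends homology of the image to homology of the kernel one homological degree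
lower, which is why m becomes m + 1. -/
theorem KoszulLinearBelow.range (hB : ∀ i j, (B i j).IsHomogeneous e) {m : ℕ}
    (h : KoszulLinearBelow m 1 (LinearMap.ker B.mulVecLin)) :
    KoszulLinearBelow (m + 1) e (LinearMap.range B.mulVecLin) := by
  intro c hc z hz hhom hcard hd
  obtain ⟨c, rfl⟩ := Nat.exists_eq_add_of_le hc
  -- The lift is chosen to be zero for large τ, so that its boundary satisfies the cardinality bound
  -- with m.
  have h1 : ∀ τ : Finset (Fin n), ∃ y : Fin b → MvPolynomial (Fin n) k,
      (∀ j, (y j).IsHomogeneous (c + 1)) ∧ B.mulVecLin y = z τ ∧ (m + 1 ≤ τ.card → y = 0) := by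
    intro τ
    by_cases hτ : m + 1 ≤ τ.card
    · exact ⟨0, fun _ => isHomogeneous_zero _ _ _, by rw [map_zero, hcard τ hτ], fun _ => rfl⟩
    · obtain ⟨y, hy, hyz⟩ := exists_homogeneous_mulVec_eq (c := c + 1) hB (hz τ) (hhom τ)
      exact ⟨y, hy, hyz, fun h => absurd h hτ⟩
  choose y hy hyz hy0 using h1
  obtain rfl := funext hyz
  obtain ⟨t, ht, htc, htd⟩ := h (c + 1) (by omega) (koszulD k y)
    (fun τ => (congrFun (koszulD_map B.mulVecLin y) τ).symm.trans (congrFun hd τ))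
    (fun τ i => by rw [koszulD_apply]; exact koszulD_isHomogeneous (fun σ => hy σ i) τ)
    (koszulD_eq_zero_of_card hy0) (koszulD_koszulD y)
  obtain ⟨s, hs, hsd⟩ := exists_koszulD_eq (z := y - t) (c := c)
    (fun τ i => (hy τ i).sub (htc τ i)) (by rw [koszulD_sub, htd, sub_self])
  refine ⟨fun τ => B.mulVecLin (s τ), fun τ => ⟨_, rfl⟩,
    fun τ => mulVec_isHomogeneous hB (hs τ), ?_⟩
  rw [koszulD_map, hsd]
  funext τ
  rw [Pi.sub_apply, map_sub, LinearMap.mem_ker.1 (ht τ), sub_zero]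

theorem koszulLinearBelow_zero
    (M : Submodule (MvPolynomial (Fin n) k) (ι → MvPolynomial (Fin n) k)) :
    KoszulLinearBelow 0 e M := by
  intro c _ z _ _ hcard _
  exact ⟨0, fun _ => M.zero_mem, fun _ _ => isHomogeneous_zero _ _ _, by
    rw [koszulD_zero]; exact (funext fun τ => hcard τ (Nat.zero_le _)).symm⟩

/-- The ideal `I`, as a submodule of the free module of rank one. -/
noncomputable def rankOne (I : Ideal (MvPolynomial (Fin n) k)) :
    Submodule (MvPolynomial (Fin n) k) (Unit → MvPolynomial (Fin n) k) :=
  Submodule.comap (LinearMap.proj (R := MvPolynomial (Fin n) k)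
    (φ := fun _ : Unit => MvPolynomial (Fin n) k) ()) I

theorem mem_rankOne {I : Ideal (MvPolynomial (Fin n) k)} {x : Unit → MvPolynomial (Fin n) k} :
    x ∈ rankOne I ↔ x () ∈ I :=
  Iff.rfl

theorem rankOne_injective : Function.Injective (rankOne (k := k) (n := n)) := by
  intro I J h
  ext p
  have : (fun _ : Unit => p) ∈ rankOne I ↔ (fun _ : Unit => p) ∈ rankOne J := by rw [h]
  exact this

theorem mulVecLin_row {b : ℕ} (f : Fin b → MvPolynomial (Fin n) k)
    (y : Fin b → MvPolynomial (Fin n) k) (i : Unit) :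
    (Matrix.of fun (_ : Unit) j => f j).mulVecLin y i =
      Fintype.linearCombination (MvPolynomial (Fin n) k) f y := by
  simp [Matrix.mulVec, dotProduct, Fintype.linearCombination_apply, mul_comm]

theorem range_mulVecLin_row {b : ℕ} (f : Fin b → MvPolynomial (Fin n) k) :
    LinearMap.range (Matrix.of fun (_ : Unit) j => f j).mulVecLin =
      rankOne (LinearMap.range (Fintype.linearCombination (MvPolynomial (Fin n) k) f)) := by
  ext x
  rw [mem_rankOne]
  constructor
  · rintro ⟨y, rfl⟩
    exact ⟨y, (mulVecLin_row f y ()).symm⟩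
  · rintro ⟨y, hy⟩
    exact ⟨y, funext fun i => (mulVecLin_row f y i).trans hy⟩

theorem ker_mulVecLin_row {b : ℕ} (f : Fin b → MvPolynomial (Fin n) k) :
    LinearMap.ker (Matrix.of fun (_ : Unit) j => f j).mulVecLin =
      LinearMap.ker (Fintype.linearCombination (MvPolynomial (Fin n) k) f) := by
  ext y
  rw [LinearMap.mem_ker, LinearMap.mem_ker, ← mulVecLin_row f y (), funext_iff]
  exact ⟨fun h => h (), fun h _ => h⟩

theorem koszulLinear_of_hasLinearResolutionOfDegree {q : ℕ} {I : Ideal (MvPolynomial (Fin n) k)}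
    (h : HasLinearResolutionOfDegree q I) : KoszulLinear q (rankOne I) := by
  obtain ⟨β, f, A, hf, hA, rfl, hker, hex⟩ := h
  -- The resolution may be infinite, so the induction is on homological degree, for all i at once.
  -- It suffices because |τ| ≤ n.
  have h1 : ∀ m i, KoszulLinearBelow m 1 (LinearMap.range (A i).mulVecLin) := by
    intro m
    induction m with
    | zero => exact fun i => koszulLinearBelow_zero _
    | succ m ih =>
      intro i
      refine KoszulLinearBelow.range (hA i) ?_
      rw [hex i]
      exact ih (i + 1)
  have hf' : ∀ (i : Unit) j, (Matrix.of (fun (_ : Unit) j => f j) i j).IsHomogeneous q :=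
    fun _ j => hf j
  rw [← range_mulVecLin_row]
  refine ⟨fun c hc x hx hhom => eq_zero_of_mem_range_of_lt hf' hx hc hhom,
    fun c hc z hz hhom hd => ?_⟩
  refine KoszulLinearBelow.range (m := n + 1) hf' ?_ c hc z hz hhom (fun τ hτ => ?_) hd
  · rw [ker_mulVecLin_row, hker]
    exact h1 _ _
  · have := τ.card_le_univ
    rw [Fintype.card_fin] at this
    omega

theorem mem_of_homogeneousComponent_mem
    {N : Submodule (MvPolynomial (Fin n) k) (ι → MvPolynomial (Fin n) k)} [Finite ι]
    {x : ι → MvPolynomial (Fin n) k} (hx : ∀ c, (fun i => homogeneousComponent c (x i)) ∈ N) :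
    x ∈ N := by
  have := Fintype.ofFinite ι
  have h : x = ∑ c ∈ Finset.range (Finset.univ.sup (fun i => (x i).totalDegree) + 1),
      fun i => homogeneousComponent c (x i) := by
    funext i
    rw [Finset.sum_apply]
    conv_lhs => rw [← sum_homogeneousComponent (x i)]
    refine Finset.sum_subset (Finset.range_mono (Nat.succ_le_succ
      (Finset.le_sup (f := fun i => (x i).totalDegree) (Finset.mem_univ i)))) fun c _ hc => ?_
    exact homogeneousComponent_eq_zero _ _ (by simpa using hc)
  rw [h]
  exact N.sum_mem fun c _ => hx c

/-- M is generated in degree e: an element of degree c + 1 > e, placed at e_∅, is a cycle, hence a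
boundary, hence a combination of variables times elements of M of degree c. -/
theorem KoszulLinear.le_of_homogeneous [Finite ι]
    {M N : Submodule (MvPolynomial (Fin n) k) (ι → MvPolynomial (Fin n) k)}
    (hM : IsGraded M) (h : KoszulLinear e M)
    (hN : ∀ x ∈ M, (∀ i, (x i).IsHomogeneous e) → x ∈ N) : M ≤ N := by
  have key : ∀ c, ∀ x ∈ M, (∀ i, (x i).IsHomogeneous c) → x ∈ N := by
    intro c
    induction c with
    | zero =>
      intro x hx hc
      rcases Nat.eq_zero_or_pos e with rfl | he
      · exact hN x hx hc
      · rw [h.1 0 he x hx hc]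
        exact N.zero_mem
    | succ c ih =>
      intro x hx hc
      rcases lt_trichotomy (c + 1) e with he | rfl | he
      · rw [h.1 _ he x hx hc]
        exact N.zero_mem
      · exact hN x hx hc
      · obtain ⟨y, hy, hyc, hyd⟩ := h.2 c (by omega) (Pi.single ∅ x)
          (fun τ => by
            rcases eq_or_ne τ ∅ with rfl | hτ
            · rwa [Pi.single_eq_same]
            · rw [Pi.single_eq_of_ne hτ]
              exact M.zero_mem)
          (fun τ i => by
            rcases eq_or_ne τ ∅ with rfl | hτ
            · rw [Pi.single_eq_same]
              exact hc i
            · rw [Pi.single_eq_of_ne hτ]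
              exact isHomogeneous_zero _ _ _)
          (by
            funext τ
            refine Finset.sum_eq_zero fun i _ => ?_
            rw [Pi.single_eq_of_ne (Finset.insert_ne_empty i τ), smul_zero, smul_zero])
        have := koszulD_mem (k := k) N (fun τ => ih (y τ) (hy τ) (hyc τ)) ∅
        rwa [hyd, Pi.single_eq_same] at this
  exact fun x hx => mem_of_homogeneousComponent_mem fun c =>
    key c _ (hM x hx c) fun i => homogeneousComponent_isHomogeneous c (x i)

/-- The columns of B form a k-basis of the degree e part of M; their independence over k is what
rules out constant syzygies. -/
theorem KoszulLinear.exists_matrix [Finite ι]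
    {M : Submodule (MvPolynomial (Fin n) k) (ι → MvPolynomial (Fin n) k)}
    (hM : IsGraded M) (h : KoszulLinear e M) :
    ∃ (b : ℕ) (B : Matrix ι (Fin b) (MvPolynomial (Fin n) k)),
      (∀ i j, (B i j).IsHomogeneous e) ∧ LinearMap.range B.mulVecLin = M ∧
      KoszulLinear 1 (LinearMap.ker B.mulVecLin) := by
  let P : Submodule k (ι → MvPolynomial (Fin n) k) :=
    Submodule.pi Set.univ fun _ => homogeneousSubmodule (Fin n) k e
  have hP : P.FG := Submodule.fg_pi fun _ => homogeneousSubmodule_fg (Fin n) k e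
  let V : Submodule k (ι → MvPolynomial (Fin n) k) := M.restrictScalars k ⊓ P
  have hPn : IsNoetherian k P := isNoetherian_of_fg_of_noetherian P hP
  have : Module.Finite k V := Module.Finite.iff_fg.2 (hP.of_le inf_le_right)
  let v := Module.finBasis k V
  let B : Matrix ι (Fin (Module.finrank k V)) (MvPolynomial (Fin n) k) :=
    Matrix.of fun i j => (v j : ι → MvPolynomial (Fin n) k) i
  have hB : ∀ i j, (B i j).IsHomogeneous e := fun i j => (v j).2.2 i trivial
  have hBv : ∀ y, B.mulVec y = ∑ j, y j • (v j : ι → MvPolynomial (Fin n) k) := by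
    intro y
    funext i
    simp [B, Matrix.mulVec, dotProduct, mul_comm]
  have hBC : ∀ a : Fin (Module.finrank k V) → k, B.mulVec (fun j => C (a j)) =
      ((∑ j, a j • v j : V) : ι → MvPolynomial (Fin n) k) := by
    intro a
    rw [hBv, AddSubmonoidClass.coe_finsetSum]
    refine Finset.sum_congr rfl fun j _ => ?_
    funext i
    simp [smul_eq_C_mul]
  have hr : LinearMap.range B.mulVecLin = M := by
    refine le_antisymm ?_ (h.le_of_homogeneous hM fun x hx hc => ?_)
    · rintro _ ⟨y, rfl⟩
      rw [Matrix.mulVecLin_apply, hBv]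
      exact M.sum_mem fun j _ => M.smul_mem _ (v j).2.1
    · refine ⟨fun j => C (v.repr ⟨x, hx, fun i _ => hc i⟩ j), ?_⟩
      rw [Matrix.mulVecLin_apply, hBC, v.sum_repr]
  refine ⟨_, B, hB, hr, KoszulLinear.ker hB (hr.symm ▸ h) fun a ha => ?_⟩
  rw [hBC, ZeroMemClass.coe_eq_zero] at ha
  exact funext (Fintype.linearIndependent_iff.1 v.linearIndependent a ha)

theorem hasLinearResolutionOfDegree_of_koszulLinear {q : ℕ} {I : Ideal (MvPolynomial (Fin n) k)}
    (hI : IsGraded (rankOne I)) (h : KoszulLinear q (rankOne I)) :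
    HasLinearResolutionOfDegree q I := by
  -- A state is a graded syzygy module that is linear in degree 1. Each step covers it by a matrix
  -- of linear forms and passes to the kernel.
  let State := {p : Σ b : ℕ, Submodule (MvPolynomial (Fin n) k) (Fin b → MvPolynomial (Fin n) k) //
    IsGraded p.2 ∧ KoszulLinear 1 p.2}
  obtain ⟨b₀, B₀, hB₀, hr₀, hk₀⟩ := h.exists_matrix hI
  have step := fun s : State => s.2.2.exists_matrix s.2.1
  choose b B hB hr hk using step
  let next : State → State := fun s => ⟨⟨b s, LinearMap.ker (B s).mulVecLin⟩,
    isGraded_ker (hB s), hk s⟩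
  let st : ℕ → State := fun i =>
    Nat.rec ⟨⟨b₀, LinearMap.ker B₀.mulVecLin⟩, isGraded_ker hB₀, hk₀⟩ (fun _ => next) i
  refine ⟨fun i => (st i).1.1, B₀ (), fun i => B (st i), hB₀ (), fun i => hB (st i), ?_, ?_,
    fun i => (hr (st (i + 1))).symm⟩
  · exact rankOne_injective ((range_mulVecLin_row (B₀ ())).symm.trans hr₀)
  · exact (ker_mulVecLin_row (B₀ ())).symm.trans (hr (st 0)).symm

end LinearResolution

/-! ### Monomial ideals: linear quotients and exchange properties -/

section MonomialIdeal

variable {k : Type*} [Field k] {n : ℕ}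

theorem koszulLinear_rankOne_iff {e : ℕ} {I : Ideal (MvPolynomial (Fin n) k)} :
    KoszulLinear e (rankOne I) ↔ (∀ c < e, ∀ p ∈ I, p.IsHomogeneous c → p = 0) ∧
      ∀ c, e ≤ c → ∀ z : Finset (Fin n) → MvPolynomial (Fin n) k, (∀ τ, z τ ∈ I) →
        (∀ τ, (z τ).IsHomogeneous (c + 1)) → koszulD k z = 0 →
        ∃ y : Finset (Fin n) → MvPolynomial (Fin n) k, (∀ τ, y τ ∈ I) ∧
          (∀ τ, (y τ).IsHomogeneous c) ∧ koszulD k y = z := by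
  refine and_congr ⟨fun h c hc p hp hh => ?_, fun h c hc x hx hh => ?_⟩
    ⟨fun h c hc z hz hh hd => ?_, fun h c hc z hz hh hd => ?_⟩
  · exact congrFun (h c hc (fun _ => p) hp fun _ => hh) ()
  · exact funext fun i => h c hc (x i) hx (hh i)
  · obtain ⟨y, hy, hyc, hyd⟩ := h c hc (fun τ _ => z τ) hz (fun τ _ => hh τ) (by
      funext τ i
      rw [koszulD_apply]
      exact congrFun hd τ)
    refine ⟨fun τ => y τ (), hy, fun τ => hyc τ (), funext fun τ => ?_⟩
    rw [← koszulD_apply, hyd]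
  · obtain ⟨y, hy, hyc, hyd⟩ := h c hc (fun τ => z τ ()) hz (fun τ => hh τ ()) (by
      funext τ
      rw [← koszulD_apply, hd]
      rfl)
    refine ⟨fun τ _ => y τ, hy, fun τ _ => hyc τ, funext fun τ => funext fun i => ?_⟩
    rw [koszulD_apply, hyd]

theorem mem_monomialIdeal {T : Set (Fin n →₀ ℕ)} {p : MvPolynomial (Fin n) k} :
    p ∈ monomialIdeal k T ↔ ∀ m ∈ p.support, ∃ t ∈ T, t ≤ m :=
  mem_ideal_span_monomial_image

theorem monomial_mem_monomialIdeal {T : Set (Fin n →₀ ℕ)} {m : Fin n →₀ ℕ} :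
    monomial m (1 : k) ∈ monomialIdeal k T ↔ ∃ t ∈ T, t ≤ m := by
  classical
  rw [mem_monomialIdeal, support_monomial, if_neg one_ne_zero]
  simp

theorem isGraded_rankOne_monomialIdeal (T : Set (Fin n →₀ ℕ)) :
    IsGraded (rankOne (monomialIdeal k T)) := by
  intro x hx c
  rw [mem_rankOne, mem_monomialIdeal] at hx ⊢
  intro m hm
  rw [support_homogeneousComponent, Finset.mem_filter] at hm
  exact hx m hm.1

theorem eq_of_le_of_degree_eq {s t : Fin n →₀ ℕ} (h : s ≤ t) (hd : s.degree = t.degree) :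
    s = t := by
  obtain ⟨r, rfl⟩ := exists_add_of_le h
  rw [map_add, eq_comm, Nat.add_eq_left, Finsupp.degree_eq_zero_iff] at hd
  rw [hd, add_zero]

variable {T : Set (Fin n →₀ ℕ)} {d : ℕ}

theorem monomial_mem_monomialIdeal_iff_of_degree_eq (hT : ∀ t ∈ T, t.degree = d) {m : Fin n →₀ ℕ}
    (hm : m.degree = d) : monomial m (1 : k) ∈ monomialIdeal k T ↔ m ∈ T := by
  rw [monomial_mem_monomialIdeal]
  refine ⟨?_, fun h => ⟨m, h, le_rfl⟩⟩
  rintro ⟨t, ht, hle⟩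
  rwa [← eq_of_le_of_degree_eq hle ((hT t ht).trans hm.symm)]

theorem minGens_monomialIdeal (hT : ∀ t ∈ T, t.degree = d) :
    minGens (monomialIdeal k T) = T := by
  ext m
  simp only [minGens, Set.mem_ofPred_eq, monomial_mem_monomialIdeal]
  constructor
  · rintro ⟨⟨t, ht, hle⟩, hmin⟩
    rwa [← le_antisymm hle (hmin ⟨t, ht, le_rfl⟩ hle)]
  · refine fun hm => ⟨⟨m, hm, le_rfl⟩, ?_⟩
    rintro m' ⟨t, ht, hle⟩ hle'
    have := eq_of_le_of_degree_eq (hle.trans hle') ((hT t ht).trans (hT m hm).symm)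
    rwa [← this]

theorem eq_zero_of_mem_monomialIdeal_of_lt (hT : ∀ t ∈ T, t.degree = d) {c : ℕ} (hc : c < d)
    {p : MvPolynomial (Fin n) k} (hp : p ∈ monomialIdeal k T) (hh : p.IsHomogeneous c) : p = 0 := by
  by_contra h
  obtain ⟨m, hm⟩ := support_nonempty.2 h
  obtain ⟨t, ht, hle⟩ := mem_monomialIdeal.1 hp m hm
  have h1 : m.degree = c := by_contra fun h => mem_support_iff.1 hm (hh.coeff_eq_zero h)
  have h2 := Finsupp.degree_mono hle
  rw [hT t ht, h1] at h2
  omega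

theorem coeff_koszulD (y : Finset (Fin n) → MvPolynomial (Fin n) k) (τ : Finset (Fin n))
    (m : Fin n →₀ ℕ) : coeff m (koszulD k y τ) = ∑ i, koszulSign i τ •
      if i ∈ m.support then coeff (m - Finsupp.single i 1) (y (insert i τ)) else 0 := by
  rw [koszulD, coeff_sum]
  refine Finset.sum_congr rfl fun i _ => ?_
  rw [← coeff_X_mul', smul_eq_mul]
  exact map_zsmul (coeffAddMonoidHom m) _ _

theorem koszulD_monomial_mul (u : Fin n →₀ ℕ) (z : Finset (Fin n) → MvPolynomial (Fin n) k) :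
    koszulD k (fun τ => monomial u 1 * z τ) = fun τ => monomial u 1 * koszulD k z τ := by
  ext1 τ
  simp only [koszulD, Finset.mul_sum, smul_eq_mul, zsmul_eq_mul, mul_left_comm]

/-- Adding a generator whose colon ideal is generated by variables preserves linearity. -/
theorem koszulLinear_insert {u : Fin n →₀ ℕ} (hT : ∀ t ∈ T, t.degree = d) (hu : u.degree = d)
    {A : Set (Fin n)} (hA : ∀ s : MvPolynomial (Fin n) k, monomial u 1 * s ∈ monomialIdeal k T ↔
      s ∈ Ideal.span ((X : Fin n → MvPolynomial (Fin n) k) '' A))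
    (h : KoszulLinear d (rankOne (monomialIdeal k T))) :
    KoszulLinear d (rankOne (monomialIdeal k (insert u T))) := by
  have hT' : ∀ t ∈ insert u T, t.degree = d := by
    rintro t (rfl | ht)
    exacts [hu, hT t ht]
  have hle : monomialIdeal k T ≤ monomialIdeal k (insert u T) :=
    Ideal.span_mono (Set.image_mono (Set.subset_insert u T))
  rw [koszulLinear_rankOne_iff] at h ⊢
  refine ⟨fun c hc p hp hh => eq_zero_of_mem_monomialIdeal_of_lt hT' hc hp hh,
    fun c hc z hz hh hd => ?_⟩
  obtain ⟨c, rfl⟩ := Nat.exists_eq_add_of_le' hc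
  let s : Finset (Fin n) → MvPolynomial (Fin n) k := fun τ => (z τ).divMonomial u
  let a : Finset (Fin n) → MvPolynomial (Fin n) k := fun τ => (z τ).modMonomial u
  have hzsa : ∀ τ, monomial u 1 * s τ + a τ = z τ := fun τ => divMonomial_add_modMonomial (z τ) u
  have hs : ∀ τ, (s τ).IsHomogeneous (c + 1) := fun τ =>
    isHomogeneous_divMonomial hu (by simpa only [add_right_comm] using hh τ)
  have ha : ∀ τ, a τ ∈ monomialIdeal k T := by
    intro τ
    rw [mem_monomialIdeal]
    intro m hm
    rw [mem_support_iff] at hm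
    by_cases hum : u ≤ m
    · exact absurd (coeff_modMonomial_of_le _ hum) hm
    · rw [coeff_modMonomial_of_not_le _ hum, ← mem_support_iff] at hm
      obtain ⟨t, rfl | ht, htm⟩ := mem_monomialIdeal.1 (hz τ) m hm
      exacts [absurd htm hum, ⟨t, ht, htm⟩]
  -- Since z = u s + a is a cycle and a has coefficients in (T), s is a cycle modulo (T) : u.
  have hds : ∀ τ, koszulD k s τ ∈ Ideal.span ((X : Fin n → MvPolynomial (Fin n) k) '' A) := by
    intro τ
    rw [← hA]
    have h1 : koszulD k z = (fun τ => monomial u 1 * koszulD k s τ) + koszulD k a := by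
      rw [← koszulD_monomial_mul, ← koszulD_add]
      exact congrArg _ (funext fun τ => (hzsa τ).symm)
    rw [hd] at h1
    have h2 := congrFun h1 τ
    rw [Pi.zero_apply, Pi.add_apply] at h2
    rw [eq_neg_of_add_eq_zero_left h2.symm]
    exact neg_mem (koszulD_mem _ ha τ)
  obtain ⟨y, hy, hys⟩ := exists_koszulD_of_mem_span_X A hs hds
  have huy : ∀ τ, (monomial u 1 * y τ).IsHomogeneous (c + d) := fun τ => by
    rw [add_comm]
    exact (isHomogeneous_monomial (1 : k) hu).mul (hy τ)
  obtain ⟨y', hy', hyc', hyd'⟩ := h.2 (c + d) hc (z - koszulD k fun τ => monomial u 1 * y τ)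
    (fun τ => by
      rw [Pi.sub_apply, koszulD_monomial_mul, ← hzsa τ, add_sub_right_comm, ← mul_sub]
      exact add_mem ((hA _).2 (hys τ)) (ha τ))
    (fun τ => (hh τ).sub (koszulD_isHomogeneous huy τ))
    (by rw [koszulD_sub, hd, koszulD_koszulD, sub_zero])
  refine ⟨(fun τ => monomial u 1 * y τ) + y', fun τ => add_mem ?_ (hle (hy' τ)),
    fun τ => (huy τ).add (hyc' τ), by rw [koszulD_add, hyd', add_sub_cancel]⟩
  exact Ideal.mul_mem_right _ _ (monomial_mem_monomialIdeal.2 ⟨u, Set.mem_insert u T, le_rfl⟩)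

theorem koszulLinear_rankOne_bot (e : ℕ) :
    KoszulLinear e (rankOne (⊥ : Ideal (MvPolynomial (Fin n) k))) := by
  rw [koszulLinear_rankOne_iff]
  exact ⟨fun _ _ p hp _ => hp, fun c _ z hz _ _ => ⟨0, fun _ => zero_mem _,
    fun _ => isHomogeneous_zero _ _ _, by rw [koszulD_zero]; exact (funext hz).symm⟩⟩

theorem koszulLinear_of_hasLinearQuotients (hT : ∀ t ∈ T, t.degree = d)
    (h : HasLinearQuotients (monomialIdeal k T)) :
    KoszulLinear d (rankOne (monomialIdeal k T)) := by
  obtain ⟨l, -, hl, hcolon⟩ := h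
  rw [minGens_monomialIdeal hT] at hl
  have hbot : monomialIdeal k (∅ : Set (Fin n →₀ ℕ)) = ⊥ := by
    rw [monomialIdeal, Set.image_empty, Ideal.span_empty]
  have key : ∀ j ≤ l.length, KoszulLinear d (rankOne (monomialIdeal k {m | m ∈ l.take j})) := by
    intro j
    induction j with
    | zero =>
      intro _
      simp only [List.take_zero, List.not_mem_nil, Set.ofPred_false, hbot]
      exact koszulLinear_rankOne_bot d
    | succ j ih =>
      intro hj
      have hset : {m | m ∈ l.take (j + 1)} = insert l[j] {m | m ∈ l.take j} := by
        ext m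
        simp only [List.take_add_one, List.getElem?_eq_getElem hj, Option.toList_some,
          List.mem_append, List.mem_singleton, Set.mem_ofPred_eq, Set.mem_insert_iff, or_comm]
      have hmem : ∀ t ∈ {m | m ∈ l.take j}, t.degree = d := fun t ht =>
        hT t ((hl t).1 (List.mem_of_mem_take ht))
      have hdeg : l[j].degree = d := hT _ ((hl _).1 (List.getElem_mem _))
      rw [hset]
      rcases Nat.eq_zero_or_pos j with rfl | hj0
      -- For the first generator the colon ideal is 0 : u = 0, generated by no variables.
      · refine koszulLinear_insert hmem hdeg (A := ∅) (fun s => ?_) (ih (by omega))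
        simp [hbot]
      · obtain ⟨A, hA⟩ := hcolon j hj hj0
        refine koszulLinear_insert hmem hdeg (A := A) (fun s => ?_) (ih (by omega))
        rw [← hA, Submodule.mem_colon_singleton, smul_eq_mul, mul_comm]
  have := key l.length le_rfl
  rw [List.take_length] at this
  convert this using 3
  ext m
  exact (hl m).symm

/-- If q < d, a generator at e_∅ would bound an element of I with coefficients of degree d - 1,
which is zero. If q > d, I would contain no nonzero form of degree d. -/
theorem eq_of_koszulLinear_monomialIdeal {q : ℕ} (hT : ∀ t ∈ T, t.degree = d) (hd : 0 < d)
    (hne : T.Nonempty) (h : KoszulLinear q (rankOne (monomialIdeal k T))) : q = d := by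
  rw [koszulLinear_rankOne_iff] at h
  obtain ⟨u, hu⟩ := hne
  have hmem : monomial u (1 : k) ∈ monomialIdeal k T :=
    monomial_mem_monomialIdeal.2 ⟨u, hu, le_rfl⟩
  have hhom := isHomogeneous_monomial (1 : k) (hT u hu)
  rcases lt_trichotomy q d with hlt | heq | hgt
  · exfalso
    obtain ⟨c, rfl⟩ : ∃ c, d = c + 1 := ⟨d - 1, by omega⟩
    obtain ⟨y, hy, hyc, hyd⟩ := h.2 c (by omega) (Pi.single ∅ (monomial u 1))
      (fun τ => by
        rcases eq_or_ne τ ∅ with rfl | hτ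
        · rwa [Pi.single_eq_same]
        · rw [Pi.single_eq_of_ne hτ]
          exact zero_mem _)
      (fun τ => by
        rcases eq_or_ne τ ∅ with rfl | hτ
        · rwa [Pi.single_eq_same]
        · rw [Pi.single_eq_of_ne hτ]
          exact isHomogeneous_zero _ _ _)
      (by
        funext τ
        refine Finset.sum_eq_zero fun i _ => ?_
        rw [Pi.single_eq_of_ne (Finset.insert_ne_empty i τ), smul_zero, smul_zero])
    have hy0 : y = 0 := funext fun τ =>
      eq_zero_of_mem_monomialIdeal_of_lt hT (Nat.lt_succ_self c) (hy τ) (hyc τ)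
    rw [hy0, koszulD_zero] at hyd
    have := congrFun hyd ∅
    rw [Pi.single_eq_same, Pi.zero_apply, eq_comm, monomial_eq_zero] at this
    exact one_ne_zero this
  · exact heq
  · have := h.1 d hgt _ hmem hhom
    rw [monomial_eq_zero] at this
    exact absurd this one_ne_zero

/-- If `w ∉ I` is a monomial whose last variable is `x_q` and `xᵢ w ∈ I` for all `i < q`, then
`w` induces a Koszul cycle of `I` on `e_i`, `i < q`, which has to be a boundary. -/
theorem KoszulLinear.exchange_mem (hd : 0 < d)
    (h : KoszulLinear d (rankOne (monomialIdeal k T))) {w : Fin n →₀ ℕ} (hw : w.degree = d)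
    (hwI : monomial w (1 : k) ∉ monomialIdeal k T) {p q : Fin n} (hpq : p < q) (hq : w q ≠ 0)
    (hmax : ∀ i, q < i → w i = 0)
    (hlt : ∀ i < q, X i * monomial w (1 : k) ∈ monomialIdeal k T) :
    monomial (w + Finsupp.single p 1 - Finsupp.single q 1) (1 : k) ∈ monomialIdeal k T := by
  rw [koszulLinear_rankOne_iff] at h
  set σ : Finset (Fin n) := Finset.Iio q with hσ
  let ω : Finset (Fin n) → MvPolynomial (Fin n) k := Pi.single σ (monomial w 1)
  have hω : ∀ τ, (ω τ).IsHomogeneous d := by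
    intro τ
    rcases eq_or_ne τ σ with rfl | hτ
    · simp only [ω, Pi.single_eq_same]
      exact isHomogeneous_monomial _ hw
    · simp only [ω, Pi.single_eq_of_ne hτ]
      exact isHomogeneous_zero _ _ _
  have hdω : ∀ τ, koszulD k ω τ ∈ monomialIdeal k T := by
    intro τ
    refine Ideal.sum_mem _ fun i _ => zsmul_mem ?_ _
    by_cases hi : insert i τ = σ
    · have hiσ := Finset.mem_insert_self i τ
      rw [hi] at hiσ
      simp only [ω, hi, Pi.single_eq_same]
      exact hlt i (Finset.mem_Iio.1 hiσ)
    · simp only [ω, Pi.single_eq_of_ne hi, smul_zero]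
      exact zero_mem _
  obtain ⟨z, hz, hzc, hzd⟩ := h.2 d le_rfl (koszulD k ω) hdω (koszulD_isHomogeneous hω)
    (koszulD_koszulD ω)
  obtain ⟨c, rfl⟩ : ∃ c, d = c + 1 := ⟨d - 1, by omega⟩
  obtain ⟨y, -, hy⟩ := exists_koszulD_of_mem_span_X ∅ (z := ω - z)
    (fun τ => (hω τ).sub (hzc τ)) (by simp [koszulD_sub, hzd])
  replace hy : ∀ τ, koszulD k y τ = ω τ - z τ := fun τ => by
    have := hy τ
    rw [Set.image_empty, Ideal.span_empty, Ideal.mem_bot] at this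
    exact (sub_eq_zero.1 this).symm
  have hcoeff : ∀ (m : Fin n →₀ ℕ) (τ : Finset (Fin n)), monomial m (1 : k) ∉ monomialIdeal k T →
      coeff m (z τ) = 0 := by
    intro m τ hm
    by_contra hne
    exact hm (monomial_mem_monomialIdeal.2 (mem_monomialIdeal.1 (hz τ) m (mem_support_iff.2 hne)))
  have hqσ : q ∉ σ := by simp [hσ]
  -- Compare coefficients of w at e_σ in ∂y = ω - z. As w ∉ I, z contributes nothing, and only i = q
  -- survives: i < q lies in σ, and w has no variable beyond x_q.
  have h1 : coeff (w - Finsupp.single q 1) (y (insert q σ)) ≠ 0 := by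
    intro h0
    have h2 := coeff_koszulD y σ w
    rw [hy, coeff_sub, hcoeff w σ hwI, Finset.sum_eq_zero] at h2
    · simp [ω] at h2
    · intro i _
      rcases lt_trichotomy i q with hi | rfl | hi
      · rw [koszulSign_of_mem (Finset.mem_Iio.2 hi), zero_smul]
      · rw [h0, ite_self, smul_zero]
      · rw [if_neg (by simp [hmax i hi]), smul_zero]
  by_contra hcon
  -- The same coefficient of y also enters ∂y at e_τ, as the only term contributing to x_p w/x_q. If
  -- that monomial were outside I, neither ω nor z could account for it.
  set τ : Finset (Fin n) := insert q (σ.erase p) with hτ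
  have hpτ : p ∉ τ := by simp [hτ, hpq.ne]
  have hins : insert p τ = insert q σ := by
    rw [hτ, Finset.insert_comm, Finset.insert_erase (Finset.mem_Iio.2 hpq)]
  have hτσ : τ ≠ σ := fun h => hqσ (h ▸ Finset.mem_insert_self q _)
  have h2 := coeff_koszulD y τ (w + Finsupp.single p 1 - Finsupp.single q 1)
  have hsub : w + Finsupp.single p 1 - Finsupp.single q 1 - Finsupp.single p 1 =
      w - Finsupp.single q 1 := by
    rw [tsub_right_comm, add_tsub_cancel_right]
  rw [hy, coeff_sub, hcoeff _ τ hcon, Finset.sum_eq_single p, hins, hsub, if_pos] at h2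
  · simp only [ω, Pi.single_eq_of_ne hτσ, coeff_zero, sub_zero] at h2
    have h3 := koszulSign_mul_self hpτ
    apply h1
    rw [← one_smul ℤ (coeff _ _), ← h3, mul_smul, ← h2, smul_zero]
  · simp [Finsupp.single_eq_of_ne hpq.ne]
  · intro i _ hip
    rcases lt_or_ge q i with hi | hi
    · rw [if_neg, smul_zero]
      simp [hmax i hi, Finsupp.single_eq_of_ne hip]
    · rw [koszulSign_of_mem, zero_smul]
      rcases hi.eq_or_lt with rfl | hi
      · exact Finset.mem_insert_self _ _
      · exact Finset.mem_insert_of_mem (Finset.mem_erase.2 ⟨hip, Finset.mem_Iio.2 hi⟩)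
  · simp

/-- If an earlier w' divides m w, then xᵢ divides m whenever wᵢ < w'ᵢ. The exchange hypothesis
supplies such an xᵢ already in the colon ideal. -/
theorem isLinearQuotientsOrdering_of_exchange (hT : ∀ t ∈ T, t.degree = d)
    {r : (Fin n →₀ ℕ) → (Fin n →₀ ℕ) → Prop} (hr : ∀ a b, r a b → ¬ r b a)
    {l : List (Fin n →₀ ℕ)} (hnodup : l.Nodup) (hl : ∀ m, m ∈ l ↔ m ∈ T) (hlr : l.Pairwise r)
    (hex : ∀ w ∈ T, ∀ w' ∈ T, r w' w →
      ∃ i, w i < w' i ∧ ∃ w'' ∈ T, r w'' w ∧ w'' ≤ w + Finsupp.single i 1) :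
    IsLinearQuotientsOrdering (monomialIdeal k T) l := by
  refine ⟨hnodup, fun m => by rw [hl, minGens_monomialIdeal hT], fun j hj _ => ?_⟩
  have hlr' := List.pairwise_iff_getElem.1 hlr
  have htake : ∀ m, m ∈ l.take j ↔ m ∈ T ∧ r m l[j] := by
    intro m
    rw [List.mem_take_iff_getElem]
    constructor
    · rintro ⟨i, hi, rfl⟩
      exact ⟨(hl _).1 (List.getElem_mem _), hlr' _ _ _ _ (by omega)⟩
    · rintro ⟨hm, hmr⟩
      obtain ⟨i, hi, rfl⟩ := List.getElem_of_mem ((hl m).2 hm)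
      rcases lt_trichotomy i j with hij | rfl | hij
      · exact ⟨i, by omega, rfl⟩
      · exact absurd hmr (hr _ _ hmr)
      · exact absurd hmr (hr _ _ (hlr' _ _ _ _ hij))
  have hjT : l[j] ∈ T := (hl _).1 (List.getElem_mem _)
  have hmul : ∀ (s : MvPolynomial (Fin n) k) (m : Fin n →₀ ℕ), m ∈ s.support →
      m + l[j] ∈ (s * monomial l[j] 1).support := by
    intro s m hm
    rw [mem_support_iff] at hm ⊢
    rwa [coeff_mul_monomial, mul_one]
  refine ⟨{i | ∃ w'' ∈ T, r w'' l[j] ∧ w'' ≤ l[j] + Finsupp.single i 1}, le_antisymm ?_ ?_⟩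
  · intro s hs
    rw [Submodule.mem_colon_singleton, smul_eq_mul, mem_monomialIdeal] at hs
    rw [mem_ideal_span_X_image]
    intro m hm
    obtain ⟨w', hw', hle⟩ := hs _ (hmul s m hm)
    obtain ⟨hw'T, hw'r⟩ := (htake w').1 hw'
    obtain ⟨i, hi, hi'⟩ := hex _ hjT w' hw'T hw'r
    refine ⟨i, hi', fun h0 => ?_⟩
    have := hle i
    rw [Finsupp.add_apply, h0, zero_add] at this
    omega
  · rw [Ideal.span_le]
    rintro _ ⟨i, ⟨w'', hw'', hr'', hle⟩, rfl⟩
    rw [SetLike.mem_coe, Submodule.mem_colon_singleton, smul_eq_mul, X, monomial_mul, one_mul,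
      monomial_mem_monomialIdeal]
    exact ⟨w'', (htake w'').2 ⟨hw'', hr''⟩, by rwa [add_comm]⟩

end MonomialIdeal

/-! ### Lexicographic comparison of monomials of equal degree -/

section Lex

variable {n : ℕ}

theorem toLex_lt_iff {a b : Fin n →₀ ℕ} :
    toLex a < toLex b ↔ ∃ i, (∀ j < i, a j = b j) ∧ a i < b i :=
  Finsupp.Lex.lt_iff

/-- If `a < b` lexicographically and both have the same degree, `a` is larger than `b` at some
later index. -/
theorem exists_gt_of_degree_eq {a b : Fin n →₀ ℕ} (hd : a.degree = b.degree) {s : Fin n}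
    (hs : ∀ j < s, a j = b j) (hlt : a s < b s) : ∃ l, s < l ∧ b l < a l := by
  by_contra! hcon
  rw [Finsupp.degree_eq_sum, Finsupp.degree_eq_sum] at hd
  refine hd.not_lt (Finset.sum_lt_sum (fun i _ => ?_) ⟨s, Finset.mem_univ s, hlt⟩)
  rcases lt_trichotomy i s with hi | rfl | hi
  exacts [(hs i hi).le, hlt.le, hcon i hi]

theorem exists_last {z : Fin n →₀ ℕ} {l : Fin n} (hl : z l ≠ 0) :
    ∃ q, l ≤ q ∧ z q ≠ 0 ∧ ∀ i, q < i → z i = 0 := by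
  have hl' : l ∈ z.support := Finsupp.mem_support_iff.2 hl
  refine ⟨z.support.max' ⟨l, hl'⟩, Finset.le_max' _ _ hl',
    Finsupp.mem_support_iff.1 (Finset.max'_mem _ _), fun i hi => ?_⟩
  by_contra h
  exact hi.not_ge (Finset.le_max' _ _ (Finsupp.mem_support_iff.2 h))

theorem degree_add_single {d : ℕ} {w : Fin n →₀ ℕ} (hw : w.degree = d) (i : Fin n) :
    (w + Finsupp.single i 1).degree = d + 1 := by
  rw [map_add, hw, Finsupp.degree_single]

/-- The monomial `xᵢ w / x_l`. -/
noncomputable def exchange (w : Fin n →₀ ℕ) (i l : Fin n) : Fin n →₀ ℕ :=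
  w + Finsupp.single i 1 - Finsupp.single l 1

theorem exchange_apply (w : Fin n →₀ ℕ) (i l j : Fin n) :
    exchange w i l j = w j + (if i = j then 1 else 0) - if l = j then 1 else 0 := by
  simp [exchange, Finsupp.single_apply]

theorem exchange_add {w : Fin n →₀ ℕ} {i l : Fin n} (hl : w l ≠ 0) :
    exchange w i l + Finsupp.single l 1 = w + Finsupp.single i 1 := by
  refine tsub_add_cancel_of_le (le_trans ?_ le_self_add)
  rw [Finsupp.single_le_iff]
  omega

theorem exchange_le (w : Fin n →₀ ℕ) (i l : Fin n) : exchange w i l ≤ w + Finsupp.single i 1 :=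
  tsub_le_self

theorem degree_exchange {w : Fin n →₀ ℕ} {i l : Fin n} (hl : w l ≠ 0) :
    (exchange w i l).degree = w.degree := by
  have := congrArg Finsupp.degree (exchange_add (i := i) hl)
  rw [map_add, map_add, Finsupp.degree_single, Finsupp.degree_single] at this
  omega

theorem toLex_lt_exchange (w : Fin n →₀ ℕ) {i l : Fin n} (hil : i < l) :
    toLex w < toLex (exchange w i l) := by
  refine toLex_lt_iff.2 ⟨i, fun j hj => ?_, ?_⟩
  · rw [exchange_apply, if_neg hj.ne', if_neg (hj.trans hil).ne']
    rfl
  · rw [exchange_apply, if_pos rfl, if_neg hil.ne']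
    omega

/-- Replacing the last variable of a monomial by `xᵢ` is monotone. -/
theorem toLex_exchange_last_le {z w : Fin n →₀ ℕ} (hd : z.degree = w.degree)
    (hzw : toLex z ≤ toLex w) (i : Fin n) {q r : Fin n} (hzq : z q ≠ 0) (hq : ∀ j, q < j → z j = 0)
    (hwr : w r ≠ 0) (hr : ∀ j, r < j → w j = 0) :
    toLex (exchange z i q) ≤ toLex (exchange w i r) := by
  by_contra! hlt
  refine hzw.not_gt ?_
  obtain ⟨s, hs, hlt⟩ := toLex_lt_iff.1 hlt
  obtain ⟨l, hsl, hl⟩ := exists_gt_of_degree_eq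
    ((degree_exchange hwr).trans (hd.symm.trans (degree_exchange hzq).symm)) hs hlt
  have h1 : ∀ j, exchange w i r j + (if r = j then 1 else 0) = w j + if i = j then 1 else 0 := by
    intro j
    have := DFunLike.congr_fun (exchange_add (i := i) hwr) j
    simpa [Finsupp.single_apply] using this
  have h2 : ∀ j, exchange z i q j + (if q = j then 1 else 0) = z j + if i = j then 1 else 0 := by
    intro j
    have := DFunLike.congr_fun (exchange_add (i := i) hzq) j
    simpa [Finsupp.single_apply] using this
  have hzl : ∀ j, z j = 0 → q ≠ j := by
    rintro j hj rfl
    exact hzq hj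
  have hwl : ∀ j, w j = 0 → r ≠ j := by
    rintro j hj rfl
    exact hwr hj
  -- The removed variables sit at r ≥ l > s and q ≥ s, so removing them cannot have created the
  -- inequality at s: already w < z there.
  have hlr : l ≤ r := by
    by_contra! hrl
    have h3 := h1 l
    have h4 := h2 l
    rw [hr l hrl, if_neg hrl.ne] at h3
    split_ifs at h3 h4 <;> have := hzl l <;> omega
  have hsq : s ≤ q := by
    by_contra! hqs
    have h3 := h1 s
    have h4 := h2 s
    rw [hq s hqs, if_neg hqs.ne] at h4
    split_ifs at h3 h4 <;> have := hwl s <;> omega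
  refine toLex_lt_iff.2 ⟨s, fun j hj => ?_, ?_⟩
  · have h3 := h1 j
    have h4 := h2 j
    rw [if_neg (hj.trans (hsl.trans_le hlr)).ne'] at h3
    rw [if_neg (hj.trans_le hsq).ne'] at h4
    have := hs j hj
    omega
  · have h3 := h1 s
    have h4 := h2 s
    rw [if_neg (hsl.trans_le hlr).ne'] at h3
    omega

end Lex

/-! ### Completely lexsegment ideals and the order ≺ -/

section Segment

variable {n : ℕ} [NeZero n] {d : ℕ} {u v : Fin n →₀ ℕ}

theorem apply_zero_le_of_toLex_le {a b : Fin n →₀ ℕ} (h : toLex a ≤ toLex b) : a 0 ≤ b 0 := by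
  by_contra! hlt
  exact h.not_gt (toLex_lt_iff.2 ⟨0, fun j hj => absurd hj (Fin.zero_le j).not_gt, hlt⟩)

theorem toLex_lt_of_apply_zero_lt {a b : Fin n →₀ ℕ} (h : a 0 < b 0) : toLex a < toLex b :=
  lt_of_not_ge fun h' => h.not_ge (apply_zero_le_of_toLex_le h')

theorem ne_zero_of_lt_of_apply_zero_eq {a b : Fin n →₀ ℕ} (h0 : a 0 = b 0) {s : Fin n}
    (h : a s < b s) : s ≠ 0 := by
  rintro rfl
  omega

/-- The first shadow is a lexsegment containing x₁u and x_l v, hence everything between them. -/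
theorem IsCompletelyLexSegment.exists_mem_of_mem_Icc
    (hL : IsCompletelyLexSegment d (lexSegment d u v)) (hu : u.degree = d) (hv : v.degree = d)
    (huv : toLex v ≤ toLex u) {m : Fin n →₀ ℕ} (hm : m.degree = d + 1) {l : Fin n}
    (hvm : toLex (v + Finsupp.single l 1) ≤ toLex m)
    (hmu : toLex m ≤ toLex (u + Finsupp.single 0 1)) :
    ∃ w ∈ lexSegment d u v, ∃ i : Fin n, m = w + Finsupp.single i 1 := by
  obtain ⟨u', v', -, -, -, hS⟩ := hL 1
  rw [Function.iterate_one] at hS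
  have h1 : u + Finsupp.single 0 1 ∈ shadow (lexSegment d u v) :=
    ⟨u, ⟨hu, le_rfl, huv⟩, 0, rfl⟩
  have h2 : v + Finsupp.single l 1 ∈ shadow (lexSegment d u v) :=
    ⟨v, ⟨hv, huv, le_rfl⟩, l, rfl⟩
  rw [hS] at h1 h2
  have h3 : m ∈ shadow (lexSegment d u v) := by
    rw [hS]
    exact ⟨hm, hmu.trans h1.2.1, h2.2.2.trans hvm⟩
  exact h3

/-- If `u` and `v` have the same exponent of `x₁`, then `u` is the largest monomial with this
exponent. -/
theorem IsCompletelyLexSegment.le_of_apply_zero_eq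
    (hL : IsCompletelyLexSegment d (lexSegment d u v)) (hu : u.degree = d) (hv : v.degree = d)
    (huv : toLex v ≤ toLex u) (h0 : u 0 = v 0) {y : Fin n →₀ ℕ} (hy : y.degree = d)
    (hy0 : y 0 = u 0) : toLex y ≤ toLex u := by
  by_contra! hlt
  obtain ⟨s, -, hs⟩ := toLex_lt_iff.1 hlt
  have hs0 : (s : ℕ) ≠ 0 := fun h => ne_zero_of_lt_of_apply_zero_eq hy0.symm hs (Fin.ext h)
  have hn : 1 < n := by omega
  have h10 : (⟨1, hn⟩ : Fin n) ≠ 0 := fun h => by simpa using congrArg Fin.val h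
  -- If y > u had the same x₁-exponent, x₂y would lie between x₂v and x₁u, so x₂y = t xᵢ with t in
  -- the segment. Either t = y or t has a larger x₂-exponent than y; both give t ≥ y > u.
  obtain ⟨t, ⟨-, htu, htv⟩, i, hi⟩ := hL.exists_mem_of_mem_Icc hu hv huv
    (degree_add_single hy ⟨1, hn⟩) (l := ⟨1, hn⟩)
    (add_le_add_left (huv.trans hlt.le) (toLex (Finsupp.single _ 1)))
    (toLex_lt_of_apply_zero_lt (by simp [hy0])).le
  have ht0 : t 0 = y 0 := by
    have h1 := apply_zero_le_of_toLex_le htu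
    have h2 := apply_zero_le_of_toLex_le htv
    omega
  have hval : ∀ j, y j + (if (⟨1, hn⟩ : Fin n) = j then 1 else 0) = t j + if i = j then 1 else 0 := by
    intro j
    have := DFunLike.congr_fun hi j
    simpa [Finsupp.single_apply] using this
  refine (htu.trans_lt hlt).not_ge ?_
  rcases eq_or_ne i ⟨1, hn⟩ with rfl | hi1
  · rw [add_right_cancel hi]
  · refine (toLex_lt_iff.2 ⟨⟨1, hn⟩, fun j hj => ?_, ?_⟩).le
    · have : j = 0 := Fin.ext (Nat.lt_one_iff.1 hj)
      rw [this, ht0]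
    · have := hval ⟨1, hn⟩
      rw [if_pos rfl, if_neg hi1] at this
      omega

/-- The condition on the monomials below `v` under which a completely lexsegment ideal is linear:
`x₁ z / x_q ≤ u` if `x_q` is the last variable of `z < v`. -/
def LastExchangeLe (d : ℕ) (u v : Fin n →₀ ℕ) : Prop :=
  ∀ z : Fin n →₀ ℕ, z.degree = d → toLex z < toLex v → z 0 = v 0 →
    ∀ q, z q ≠ 0 → (∀ i, q < i → z i = 0) → toLex (exchange z 0 q) ≤ toLex u

theorem lastExchangeLe_of_koszulLinear {k : Type*} [Field k]
    (hL : IsCompletelyLexSegment d (lexSegment d u v)) (hu : u.degree = d) (hv : v.degree = d)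
    (huv : toLex v ≤ toLex u) (h0 : v 0 < u 0)
    (hK : KoszulLinear d (rankOne (monomialIdeal k (lexSegment d u v)))) :
    LastExchangeLe d u v := by
  have hT : ∀ t ∈ lexSegment d u v, t.degree = d := fun t ht => ht.1
  have hd : 0 < d := by
    have := Finsupp.le_degree 0 u
    omega
  intro z hz hzv hz0 q hzq hq
  let Z : Set (Fin n →₀ ℕ) := {z | z.degree = d ∧ toLex z < toLex v ∧ z 0 = v 0}
  have hZ : Z.Finite := (Finsupp.finite_of_degree_eq d).subset fun z hz => hz.1
  obtain ⟨w, ⟨hw, hwv, hw0⟩, hmax⟩ := Set.exists_max_image Z toLex hZ ⟨z, hz, hzv, hz0⟩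
  have hzw := hmax z ⟨hz, hzv, hz0⟩
  obtain ⟨s, hs, hlt⟩ := toLex_lt_iff.1 hwv
  have hs0 := ne_zero_of_lt_of_apply_zero_eq hw0 hlt
  obtain ⟨l, hsl, hl⟩ := exists_gt_of_degree_eq (hw.trans hv.symm) hs hlt
  obtain ⟨r, hlr, hwr, hr⟩ := exists_last (Nat.ne_zero_of_lt hl)
  have hr0 : 0 < r := (pos_iff_ne_zero.2 hs0).trans (hsl.trans_le hlr)
  refine (toLex_exchange_last_le (hz.trans hw.symm) hzw 0 hzq hq hwr hr).trans ?_
  have hmem := hK.exchange_mem hd hw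
    (fun h => hwv.not_ge ((monomial_mem_monomialIdeal_iff_of_degree_eq hT hw).1 h).2.2)
    hr0 hwr hr (fun i hi => by
      -- For i = 0 the product lies between x_r v and x₁u, so it is in the shadow. For 0 < i < r,
      -- xᵢw/x_r exceeds w with unchanged x₁-exponent, so by maximality of w it is at least v.
      rw [X, monomial_mul, one_mul, add_comm, monomial_mem_monomialIdeal]
      rcases eq_or_ne i 0 with rfl | hi0
      · obtain ⟨t, ht, j, hj⟩ := hL.exists_mem_of_mem_Icc hu hv huv (degree_add_single hw 0)
          (l := r) (toLex_lt_of_apply_zero_lt (by simp [hw0, hr0.ne'])).le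
          (add_le_add_left (hwv.le.trans huv) (toLex (Finsupp.single _ 1)))
        exact ⟨t, ht, hj ▸ le_self_add⟩
      · have hval : exchange w i r 0 = v 0 := by
          rw [exchange_apply, if_neg hi0, if_neg hr0.ne', hw0]
          rfl
        refine ⟨exchange w i r, ⟨(degree_exchange hwr).trans hw,
          (toLex_lt_of_apply_zero_lt (by rwa [hval])).le, ?_⟩, exchange_le w i r⟩
        by_contra! hlt
        exact (toLex_lt_exchange w hi).not_ge
          (hmax _ ⟨(degree_exchange hwr).trans hw, hlt, hval⟩))
  exact ((monomial_mem_monomialIdeal_iff_of_degree_eq hT ((degree_exchange hwr).trans hw)).1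
    hmem).2.1

theorem exists_prec_of_exchange_le {w : Fin n →₀ ℕ} (hw : w ∈ lexSegment d u v) {i l : Fin n}
    (hi0 : i ≠ 0) (hil : i < l) (hwl : w l ≠ 0) (hle : toLex (exchange w i l) ≤ toLex u) :
    ∃ w'' ∈ lexSegment d u v, prec w'' w ∧ w'' ≤ w + Finsupp.single i 1 := by
  have hlt := toLex_lt_exchange w hil
  refine ⟨exchange w i l, ⟨(degree_exchange hwl).trans hw.1, hle, hw.2.2.trans hlt.le⟩,
    Or.inr ⟨?_, hlt⟩, exchange_le w i l⟩
  rw [exchange_apply, if_neg hi0, if_neg ((pos_iff_ne_zero.2 hi0).trans hil).ne']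
  rfl

theorem exists_prec_of_le_exchange {w : Fin n →₀ ℕ} (hw : w ∈ lexSegment d u v) {i : Fin n}
    (hi0 : i ≠ 0) (hw0 : w 0 ≠ 0) (hle : toLex v ≤ toLex (exchange w i 0)) :
    ∃ w'' ∈ lexSegment d u v, prec w'' w ∧ w'' ≤ w + Finsupp.single i 1 := by
  have hlt : exchange w i 0 0 < w 0 := by
    rw [exchange_apply, if_neg hi0, if_pos rfl]
    omega
  have hwu := apply_zero_le_of_toLex_le hw.2.1
  exact ⟨exchange w i 0, ⟨(degree_exchange hw0).trans hw.1,
    (toLex_lt_of_apply_zero_lt (hlt.trans_le hwu)).le, hle⟩, Or.inl hlt, exchange_le w i 0⟩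

/-- Try z = xᵢw/x₁. If z < v, then z has the same x₁-exponent as v, and with x_q its last variable,
x₁z/x_q = xᵢw/x_q is at most u and serves instead. -/
theorem LastExchangeLe.exists_prec (hE : LastExchangeLe d u v) {w : Fin n →₀ ℕ}
    (hw : w ∈ lexSegment d u v) {i l : Fin n} (hi0 : i ≠ 0) (hil : i < l) (hwl : w l ≠ 0)
    (hw0 : w 0 ≠ 0) (h0 : v 0 < w 0) :
    ∃ w'' ∈ lexSegment d u v, prec w'' w ∧ w'' ≤ w + Finsupp.single i 1 := by
  rcases le_or_gt (toLex v) (toLex (exchange w i 0)) with hle | hlt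
  · exact exists_prec_of_le_exchange hw hi0 hw0 hle
  have hz : ∀ j, j ≠ 0 → exchange w i 0 j = w j + if i = j then 1 else 0 := fun j hj => by
    rw [exchange_apply, if_neg hj.symm, Nat.sub_zero]
  have hz0 : exchange w i 0 0 = w 0 - 1 := by
    rw [exchange_apply, if_neg hi0, if_pos rfl, Nat.add_zero]
  have hl0 : l ≠ 0 := ((pos_iff_ne_zero.2 hi0).trans hil).ne'
  obtain ⟨q, hlq, hzq, hq⟩ := exists_last (z := exchange w i 0) (l := l) (by
    rw [hz l hl0]
    omega)
  have hq0 : q ≠ 0 := ((pos_iff_ne_zero.2 hl0).trans_le hlq).ne'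
  have hwq : w q ≠ 0 := by
    rwa [hz q hq0, if_neg (hil.trans_le hlq).ne] at hzq
  have hz0v := apply_zero_le_of_toLex_le hlt.le
  refine exists_prec_of_exchange_le hw hi0 (hil.trans_le hlq) hwq ?_
  have := hE (exchange w i 0) ((degree_exchange hw0).trans hw.1) hlt (by omega) q hzq hq
  convert this using 2
  rw [exchange, exchange, exchange_add hw0]

theorem exists_exchange (hor : (u 0 = v 0 ∧ ∀ y : Fin n →₀ ℕ, y.degree = d → y 0 = u 0 →
      toLex y ≤ toLex u) ∨ v 0 < u 0 ∧ LastExchangeLe d u v)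
    {w w' : Fin n →₀ ℕ} (hw : w ∈ lexSegment d u v) (hw' : w' ∈ lexSegment d u v)
    (hprec : prec w' w) : ∃ i, w i < w' i ∧
      ∃ w'' ∈ lexSegment d u v, prec w'' w ∧ w'' ≤ w + Finsupp.single i 1 := by
  have hwu := apply_zero_le_of_toLex_le hw.2.1
  have hwv := apply_zero_le_of_toLex_le hw.2.2
  have hwv' := apply_zero_le_of_toLex_le hw'.2.2
  rcases hprec with h0 | ⟨h0, hlt⟩
  · have hex : ∃ i, w i < w' i := by
      by_contra! hcon
      have h1 := hw.1.trans hw'.1.symm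
      rw [Finsupp.degree_eq_sum, Finsupp.degree_eq_sum] at h1
      exact h1.not_gt (Finset.sum_lt_sum (fun i _ => hcon i) ⟨0, Finset.mem_univ 0, h0⟩)
    -- Minimality of i matters when w has no variable after xᵢ: it then gives xᵢw/x₁ ≥ w' ≥ v.
    obtain ⟨i, hi, hmin⟩ := Set.exists_min_image {i | w i < w' i} id (Set.toFinite _) hex
    simp only [Set.mem_ofPred_eq, id] at hi hmin
    refine ⟨i, hi, ?_⟩
    have hi0 : i ≠ 0 := by
      rintro rfl
      omega
    by_cases hl : ∃ l, i < l ∧ w l ≠ 0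
    · obtain ⟨l, hil, hwl⟩ := hl
      rcases hor with h | ⟨-, hE⟩
      · omega
      · exact hE.exists_prec hw hi0 hil hwl (by omega) (by omega)
    · push Not at hl
      refine exists_prec_of_le_exchange hw hi0 (by omega) (hw'.2.2.trans ?_)
      have hz : ∀ j, j ≠ 0 → exchange w i 0 j = w j + if i = j then 1 else 0 := fun j hj => by
        rw [exchange_apply, if_neg hj.symm, Nat.sub_zero]
      by_contra! hlt
      obtain ⟨s, hs, hslt⟩ := toLex_lt_iff.1 hlt
      obtain ⟨l, hsl, hzl⟩ := exists_gt_of_degree_eq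
        ((degree_exchange (by omega)).trans (hw.1.trans hw'.1.symm)) hs hslt
      have hs0 : s ≠ 0 := by
        rintro rfl
        rw [exchange_apply, if_neg hi0, if_pos rfl] at hslt
        omega
      have his : i ≤ s := hmin s (by
        rw [hz s hs0] at hslt
        omega)
      rw [hz l ((pos_iff_ne_zero.2 hs0).trans hsl).ne', hl l (his.trans_lt hsl),
        if_neg (his.trans_lt hsl).ne] at hzl
      omega
  · obtain ⟨s, hs, hslt⟩ := toLex_lt_iff.1 hlt
    obtain ⟨l, hsl, hl⟩ := exists_gt_of_degree_eq (hw.1.trans hw'.1.symm) hs hslt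
    have hs0 := ne_zero_of_lt_of_apply_zero_eq h0.symm hslt
    have hwl : w l ≠ 0 := Nat.ne_zero_of_lt hl
    refine ⟨s, hslt, ?_⟩
    have hval : exchange w s l 0 = w 0 := by
      rw [exchange_apply, if_neg hs0, if_neg ((pos_iff_ne_zero.2 hs0).trans hsl).ne']
      rfl
    rcases hwu.lt_or_eq with hlt0 | heq
    · exact exists_prec_of_exchange_le hw hs0 hsl hwl
        (toLex_lt_of_apply_zero_lt (by rwa [hval])).le
    · rcases hor with ⟨-, hE⟩ | ⟨h1, hE⟩
      · exact exists_prec_of_exchange_le hw hs0 hsl hwl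
          (hE _ ((degree_exchange hwl).trans hw.1) (hval.trans heq))
      · exact hE.exists_prec hw hs0 hsl hwl (by omega) (by omega)

theorem prec_asymm {a b : Fin n →₀ ℕ} (h : prec a b) : ¬ prec b a := by
  rintro (h' | ⟨h', h''⟩) <;> rcases h with h | ⟨h, h2⟩
  · omega
  · omega
  · omega
  · exact h2.asymm h''

theorem exists_list_pairwise_prec {T : Set (Fin n →₀ ℕ)} (hT : T.Finite) :
    ∃ l : List (Fin n →₀ ℕ), l.Nodup ∧ (∀ m, m ∈ l ↔ m ∈ T) ∧ l.Pairwise prec := by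
  classical
  -- Sorting uses the reflexive closure of ≺; the absence of repetitions restores strictness.
  let r : (Fin n →₀ ℕ) → (Fin n →₀ ℕ) → Prop := fun a b => a = b ∨ prec a b
  have h1 : IsTrans _ r := ⟨by
    rintro a b c (rfl | hab) (rfl | hbc)
    · exact Or.inl rfl
    · exact Or.inr hbc
    · exact Or.inr hab
    · right
      rcases hab with h | ⟨h, h'⟩ <;> rcases hbc with g | ⟨g, g'⟩
      · exact Or.inl (h.trans g)
      · exact Or.inl (g ▸ h)
      · exact Or.inl (h ▸ g)
      · exact Or.inr ⟨h.trans g, g'.trans h'⟩⟩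
  have h2 : Std.Antisymm r := ⟨by
    rintro a b (rfl | hab) (h | hba)
    · rfl
    · rfl
    · exact h.symm
    · exact absurd hba (prec_asymm hab)⟩
  have h3 : Std.Total r := ⟨fun a b => by
    rcases lt_trichotomy (a 0) (b 0) with h | h | h
    · exact Or.inl (Or.inr (Or.inl h))
    · rcases lt_trichotomy (toLex a) (toLex b) with h' | h' | h'
      · exact Or.inr (Or.inr (Or.inr ⟨h.symm, h'⟩))
      · exact Or.inl (Or.inl (toLex.injective h'))
      · exact Or.inl (Or.inr (Or.inr ⟨h, h'⟩))
    · exact Or.inr (Or.inr (Or.inl h))⟩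
  refine ⟨hT.toFinset.sort r, Finset.sort_nodup _ _, fun m => by simp, ?_⟩
  exact ((Finset.pairwise_sort hT.toFinset r).and (Finset.sort_nodup hT.toFinset r)).imp
    fun h => h.1.resolve_left h.2

end Segment

end Lexsegment

open Lexsegment in
theorem theorem1p2 {k : Type*} [Field k] {n : ℕ} [NeZero n] (d : ℕ) (u v : Fin n →₀ ℕ)
    (hu : u.degree = d) (hv : v.degree = d) (huv : toLex v ≤ toLex u) (hu₁ : 0 < u 0)
    (hL : Lexsegment.IsCompletelyLexSegment d (Lexsegment.lexSegment d u v)) :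
    (Lexsegment.HasLinearResolution
        (Lexsegment.monomialIdeal k (Lexsegment.lexSegment d u v)) ↔
      Lexsegment.HasLinearQuotients
        (Lexsegment.monomialIdeal k (Lexsegment.lexSegment d u v))) ∧
    (Lexsegment.HasLinearResolution
        (Lexsegment.monomialIdeal k (Lexsegment.lexSegment d u v)) ↔
      Lexsegment.HasLinearQuotientsWrt Lexsegment.prec
        (Lexsegment.monomialIdeal k (Lexsegment.lexSegment d u v))) := by
  have hT : ∀ t ∈ lexSegment d u v, t.degree = d := fun t ht => ht.1
  have h13 : HasLinearResolution (monomialIdeal k (lexSegment d u v)) →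
      HasLinearQuotientsWrt prec (monomialIdeal k (lexSegment d u v)) := by
    rintro ⟨q, hq⟩
    have hK := koszulLinear_of_hasLinearResolutionOfDegree hq
    have hd : 0 < d := hu ▸ hu₁.trans_le (Finsupp.le_degree 0 u)
    obtain rfl := eq_of_koszulLinear_monomialIdeal hT hd ⟨u, hu, le_rfl, huv⟩ hK
    obtain ⟨l, hnodup, hl, hpair⟩ := exists_list_pairwise_prec
      ((Finsupp.finite_of_degree_eq q).subset hT)
    refine ⟨l, hpair, isLinearQuotientsOrdering_of_exchange hT (fun _ _ => prec_asymm) hnodup hl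
      hpair fun w hw w' hw' hprec => exists_exchange ?_ hw hw' hprec⟩
    rcases (apply_zero_le_of_toLex_le huv).eq_or_lt with h0 | h0
    · exact Or.inl ⟨h0.symm, fun y hy hy0 => hL.le_of_apply_zero_eq hu hv huv h0.symm hy hy0⟩
    · exact Or.inr ⟨h0, lastExchangeLe_of_koszulLinear hL hu hv huv h0 hK⟩
  have h32 : HasLinearQuotientsWrt prec (monomialIdeal k (lexSegment d u v)) →
      HasLinearQuotients (monomialIdeal k (lexSegment d u v)) :=
    fun ⟨l, _, hl⟩ => ⟨l, hl⟩
  have h21 : HasLinearQuotients (monomialIdeal k (lexSegment d u v)) →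
      HasLinearResolution (monomialIdeal k (lexSegment d u v)) :=
    fun h => ⟨d, hasLinearResolutionOfDegree_of_koszulLinear (isGraded_rankOne_monomialIdeal _)
      (koszulLinear_of_hasLinearQuotients hT h)⟩
  exact ⟨⟨fun h => h32 (h13 h), h21⟩, ⟨h13, fun h => h21 (h32 h)⟩⟩
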